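/- Let $n,r\ge 1$, and let $B^1,\dots,B^r$ be real skew-symmetric $2n\times 2n$ matrices such that $B^\tau:=\sum_{\beta}\tau_\beta B^\beta$ is invertible for every $\tau\in\mathbb R^r\setminus\{0\}$. Let $\mathcal N=\mathbb R^{2n}\times\mathbb R^r$ be the corresponding non-degenerate nilpotent Lie group of step two, with product $(\mathbf x,\mathbf t)(\mathbf y,\mathbf s)=(\mathbf x+\mathbf y,\mathbf t+\mathbf s+2B(\mathbf x,\mathbf y))$, where $B(\mathbf x,\mathbf y)=(\sum_{k,l}B^\beta_{kl}x_ky_l)_{\beta}$. For each $\tau\neq 0$ put $\dot\tau=\tau/|\tau|$ and choose an orthonormal basis $v_1^\tau,\dots,v_{2n}^\tau$ of $\mathbb R^{2n}$, depending only on $\dot\tau$, such that the orthogonal matrix $O$ with these columns satisfies that $O^tB^{\dot\tau}O$ is block diagonal with blocks $\begin{pmatrix}0&-\mu_j(\dot\tau)\\ \mu_j(\dot\tau)&0\end{pmatrix}$, $\mu_1(\dot\tau)\ge\dots\ge\mu_n(\dot\tau)\ge 0$; write $\mathbf y=\sum_k y_k^\tau v_k^\tau$ and $\mathbf y_j^\tau=(y^\tau_{2j-1},y^\tau_{2j})$.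 With the Laguerre polynomials $L_k$, for $m\in\mathbb Z_{\ge0}$ let $$Q_m(\mathbf y,\tau)=\sum_{|\mathbf k|=m}\ \prod_{j=1}^n \mu_j(\dot\tau)\,\frac{2|\tau|}{\pi}\,L_{k_j}(\sigma_j)\,e^{-\sigma_j/2},\qquad \sigma_j=2|\tau|\,\mu_j(\dot\tau)\,|\mathbf y^\tau_j|^2,$$ where $\mathbf k$ runs over $\mathbb Z_{\ge 0}^n$, and let $Q_m(\mathbf y,0)=0$. Let $$P_m(\mathbf y,\mathbf t)=\frac1{(2\pi)^r}\int_{\mathbb R^r}e^{i\mathbf t\cdot\tau}Q_m(\mathbf y,\tau)\,d\tau\qquad(\mathbf y\ne 0),$$ extended by continuity to the points $(0,\mathbf t)$, $\mathbf t\neq 0$. For a Schwartz function $\phi$ on $\mathcal N$ put $\widetilde\phi(\mathbf y,\tau)=\int_{\mathbb R^r}e^{-i\tau\cdot\mathbf t}\phi(\mathbf y,\mathbf t)\,d\mathbf t$ and $$\langle\mathscr P_m,\phi\rangle=\frac1{(2\pi)^r}\int_{\mathbb R^{2n+r}}Q_m(\mathbf y,\tau)\,\widetilde\phi(\mathbf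 y,-\tau)\,d\mathbf y\,d\tau,\qquad \langle \mathrm{p.v.}\,P_m,\phi\rangle=\lim_{\varepsilon\to0^+}\int_{\mathbb R^{2n+r}\setminus B(\mathbf 0,\varepsilon)}\phi(\mathbf y,\mathbf t)P_m(\mathbf y,\mathbf t)\,d\mathbf y\,d\mathbf t,$$ where $B(\mathbf 0,\varepsilon)=\{(\mathbf y,\mathbf t):(|\mathbf y|^4+|\mathbf t|^2)^{1/4}\le\varepsilon\}$. Then all the integrals above converge absolutely, the limit defining $\mathrm{p.v.}\,P_m$ exists for every Schwartz function $\phi$, both $\mathscr P_m$ and $\mathrm{p.v.}\,P_m$ are tempered distributions, and there is a constant $C\in\mathbb C$ such that $$\mathscr P_m=\mathrm{p.v.}\,P_m+C\,\delta_{\mathbf 0}.$$ Moreover $P_m$ has mean value zero over the homogeneous unit sphere: $$\int_{\partial B(\mathbf 0,1)}P_m\,d\sigma=0,$$ where the integral converges absolutely and $\sigma$ is the measure on $\partial B(\mathbf 0,1)$ determined by $\int_{\mathcal N}f(x)\,dx=\int_0^\infty\!\int_{\partial B(\mathbf 0,1)}f(s\omega_1,s^2\omega_2)\,d\sigma(\omega_1,\omega_2)\,s^{2n+2r-1}\,ds$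 for integrable $f$. -/

import Mathlib

open MeasureTheory Filter Topology
open scoped SchwartzMap ENNReal

noncomputable section

namespace StepTwo

/-- The first layer `ℝ^{2n}` with its Euclidean norm. -/
abbrev Horiz (n : ℕ) : Type := EuclideanSpace ℝ (Fin (2 * n))

/-- The second layer (centre) `ℝ^r` with its Euclidean norm. -/
abbrev Centre (r : ℕ) : Type := EuclideanSpace ℝ (Fin r)

/-- The underlying space `ℝ^{2n} × ℝ^r` of the group `𝒩`; its Haar measure is Lebesgue measure. -/
abbrev Space (n r : ℕ) : Type := Horiz n × Centre r

/-- The matrix `B^τ = ∑_β τ_β B^β`. -/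
def BTau {n r : ℕ} (B : Fin r → Matrix (Fin (2 * n)) (Fin (2 * n)) ℝ) (τ : Centre r) :
    Matrix (Fin (2 * n)) (Fin (2 * n)) ℝ :=
  ∑ β, τ β • B β

/-- The data of a non-degenerate nilpotent Lie group of step two on `ℝ^{2n} × ℝ^r`, with the
multiplication `(x, t) · (y, s) = (x + y, t + s + 2 B(x, y))`, where
`B(x, y) = (B^1(x, y), …, B^r(x, y))` and `B^β(x, y) = ∑ B^β_{kl} x_k y_l`: both layers are
nontrivial, each `B^β` is skew-symmetric, and `B^τ` is invertible for every `τ ≠ 0`. -/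
structure IsNondegenerate {n r : ℕ}
    (B : Fin r → Matrix (Fin (2 * n)) (Fin (2 * n)) ℝ) : Prop where
  horiz_pos : 0 < n
  centre_pos : 0 < r
  skew : ∀ β, (B β).transpose = -B β
  det_ne_zero : ∀ τ : Centre r, τ ≠ 0 → (BTau B τ).det ≠ 0

/-- An orthonormal basis `v` of `ℝ^{2n}` normalizing the skew-symmetric matrix `A`, that is
`Oᵗ A O = J` for the orthogonal matrix `O` with columns `v`, where `J` is block diagonal with
blocks `(0, -μ_j; μ_j, 0)` and `μ_1 ≥ ⋯ ≥ μ_n ≥ 0`. The vector `v_{2j-1}` is `basis (0, j)`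
and `v_{2j}` is `basis (1, j)`. -/
structure NormalFrame {n : ℕ} (A : Matrix (Fin (2 * n)) (Fin (2 * n)) ℝ) where
  basis : OrthonormalBasis (Fin 2 × Fin n) ℝ (Horiz n)
  mu : Fin n → ℝ
  mu_antitone : Antitone mu
  mu_nonneg : ∀ j, 0 ≤ mu j
  normal : ∀ a b, inner ℝ (basis a) (Matrix.toEuclideanLin A (basis b)) =
    Matrix.blockDiagonal (fun j => !![0, -mu j; mu j, 0]) a b

theorem exists_normal_basis (n : ℕ) : ∀ (V : Type) [NormedAddCommGroup V] [InnerProductSpace ℝ V]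
    [FiniteDimensional ℝ V] (_ : Module.finrank ℝ V = 2 * n) (A : V →ₗ[ℝ] V)
    (_ : ∀ x y, inner ℝ (A x) y = -inner ℝ x (A y)),
    ∃ (b : OrthonormalBasis (Fin 2 × Fin n) ℝ V) (mu : Fin n → ℝ), (∀ j, 0 ≤ mu j) ∧
      ∀ j, A (b (0, j)) = mu j • b (1, j) ∧ A (b (1, j)) = -(mu j • b (0, j)) := by
  induction n with
  | zero =>
    intro V _ _ _ hV A hA
    refine ⟨(stdOrthonormalBasis ℝ V).reindex (Fintype.equivOfCardEq (by simp [hV])),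
      0, by simp, fun j => j.elim0⟩
  | succ n ih =>
    intro V _ _ _ hV A hA
    by_cases hA0 : A = 0
    · refine ⟨(stdOrthonormalBasis ℝ V).reindex (Fintype.equivOfCardEq (by simp [hV])),
        0, by simp, fun j => by simp [hA0]⟩
    have hsym : (A ∘ₗ A).IsSymmetric := by
      intro x y
      simp [hA]
    obtain ⟨i, hi⟩ : ∃ i, hsym.eigenvalues hV i ≠ 0 := by
      by_contra! h
      apply hA0
      have h2 : A ∘ₗ A = 0 := by
        refine (hsym.eigenvectorBasis hV).toBasis.ext fun i => ?_
        simp [h i]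
      ext x
      have h3 : inner ℝ (A x) (A x) = (0 : ℝ) := by
        rw [hA]
        have := LinearMap.congr_fun h2 x
        simp only [LinearMap.comp_apply] at this
        simp [this]
      simpa using h3
    set e : V := hsym.eigenvectorBasis hV i with he
    set l : ℝ := hsym.eigenvalues hV i with hl
    have hAA : A (A e) = l • e := by
      exact hsym.apply_eigenvectorBasis hV i
    have hee : inner ℝ e e = (1 : ℝ) := by
      have : ‖e‖ = 1 := (hsym.eigenvectorBasis hV).orthonormal.1 i
      rw [real_inner_self_eq_norm_sq, this]; norm_num
    have hee' : ‖e‖ = 1 := (hsym.eigenvectorBasis hV).orthonormal.1 i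
    set m : ℝ := ‖A e‖ with hm
    have hmm : m ^ 2 = -l := by
      rw [hm, ← real_inner_self_eq_norm_sq, hA, hAA, inner_smul_right, hee, mul_one]
    have hm0 : m ≠ 0 := by
      intro h
      apply hi
      rw [h] at hmm
      linarith
    set f : V := m⁻¹ • A e with hf
    have hAe : A e = m • f := by rw [hf, smul_smul, mul_inv_cancel₀ hm0, one_smul]
    have hAf : A f = -(m • e) := by
      rw [hf, map_smul, hAA, smul_smul, ← neg_smul]
      congr 1
      have : l = -m^2 := by linarith
      rw [this]; field_simp
    have hff' : ‖f‖ = 1 := by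
      rw [hf, norm_smul, ← hm, norm_inv, hm, norm_norm, inv_mul_cancel₀]
      exact hm0
    have hskew0 : ∀ x, inner ℝ x (A x) = (0 : ℝ) := by
      intro x
      have h1 := hA x x
      rw [real_inner_comm] at h1
      linarith
    have hef : inner ℝ e f = (0 : ℝ) := by
      rw [hf, inner_smul_right, hskew0, mul_zero]
    let p : Fin 2 → V := ![e, f]
    have hp : Orthonormal ℝ p := by
      rw [orthonormal_iff_ite]
      intro a b
      fin_cases a <;> fin_cases b <;> simp [p, hee', hff', hef, real_inner_comm e f ▸ hef]
    let W : Submodule ℝ V := (Submodule.span ℝ (Set.range p))ᗮ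
    have hWmem : ∀ x, x ∈ W ↔ inner ℝ e x = (0 : ℝ) ∧ inner ℝ f x = (0 : ℝ) := by
      intro x
      simp only [W, p, Matrix.range_cons, Matrix.range_empty, Set.union_empty,
        Set.singleton_union]
      rw [Submodule.mem_orthogonal]
      constructor
      · intro h
        exact ⟨h e (Submodule.subset_span (by simp)), h f (Submodule.subset_span (by simp))⟩
      · rintro ⟨h1, h2⟩ u hu
        obtain ⟨a, b, rfl⟩ := Submodule.mem_span_pair.1 hu
        simp [inner_add_left, inner_smul_left, h1, h2]
    have hWA : ∀ x ∈ W, A x ∈ W := by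
      intro x hx
      obtain ⟨h1, h2⟩ := (hWmem x).1 hx
      rw [hWmem]
      constructor
      · have := hA e x
        rw [hAe, inner_smul_left, h2] at this
        simp at this; linarith
      · have := hA f x
        rw [hAf, inner_neg_left, inner_smul_left, h1] at this
        simp at this; linarith
    have hWd : Module.finrank ℝ W = 2 * n := by
      have h1 := (Submodule.span ℝ (Set.range p)).finrank_add_finrank_orthogonal
      have h2 : Module.finrank ℝ (Submodule.span ℝ (Set.range p)) = 2 := by
        simpa using finrank_span_eq_card hp.linearIndependent
      change _ + Module.finrank ℝ W = _ at h1
      omega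
    obtain ⟨b, mu, hmu, hb⟩ := ih W hWd (A.restrict hWA) (by
      intro x y
      simpa using hA x y)
    let v : Fin 2 × Fin (n + 1) → V := fun q =>
      Fin.cases (p q.1) (fun j => (b (q.1, j) : V)) q.2
    have hv0 : ∀ i, v (i, 0) = p i := fun i => rfl
    have hvs : ∀ i j, v (i, Fin.succ j) = (b (i, j) : V) := fun i j => rfl
    have hpb : ∀ i q, inner ℝ (p i) (b q : V) = (0 : ℝ) := by
      intro i q
      have := (hWmem _).1 (b q).2
      fin_cases i
      · exact this.1
      · exact this.2
    have hv : Orthonormal ℝ v := by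
      rw [orthonormal_iff_ite]
      rintro ⟨i, j⟩ ⟨i', j'⟩
      refine Fin.cases ?_ (fun j => ?_) j <;> refine Fin.cases ?_ (fun j' => ?_) j'
      · rw [hv0, hv0, orthonormal_iff_ite.1 hp]
        simp
      · rw [hv0, hvs, hpb]
        simp [(Fin.succ_ne_zero _).symm]
      · rw [hv0, hvs, real_inner_comm, hpb]
        simp [(Fin.succ_ne_zero _)]
      · rw [hvs, hvs, ← Submodule.coe_inner, orthonormal_iff_ite.1 b.orthonormal]
        simp
    have hcard : Fintype.card (Fin 2 × Fin (n + 1)) = Module.finrank ℝ V := by simp [hV]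
    refine ⟨(basisOfOrthonormalOfCardEqFinrank hv hcard).toOrthonormalBasis (by simpa using hv),
      Fin.cases m mu, ?_, ?_⟩
    · intro j
      refine Fin.cases ?_ (fun j => ?_) j
      · exact norm_nonneg _
      · exact hmu j
    · intro j
      simp only [Module.Basis.coe_toOrthonormalBasis, coe_basisOfOrthonormalOfCardEqFinrank]
      refine Fin.cases ?_ (fun j => ?_) j
      · simp only [hv0, p, Fin.cases_zero]
        exact ⟨hAe, hAf⟩
      · simp only [hvs, Fin.cases_succ]
        have := hb j
        exact ⟨by simpa using congrArg (Subtype.val) this.1,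
          by simpa using congrArg (Subtype.val) this.2⟩

theorem exists_antitone_basis {n : ℕ} (A : Matrix (Fin (2 * n)) (Fin (2 * n)) ℝ)
    (hA : A.transpose = -A) :
    ∃ (b : OrthonormalBasis (Fin 2 × Fin n) ℝ (Horiz n)) (mu : Fin n → ℝ),
      Antitone mu ∧ (∀ j, 0 ≤ mu j) ∧ ∀ i j, inner ℝ (b i) (Matrix.toEuclideanLin A (b j)) =
        Matrix.blockDiagonal (fun j => !![0, -mu j; mu j, 0]) i j := by
  obtain ⟨b, mu, hmu, hb⟩ := exists_normal_basis n (Horiz n) (by simp)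
    (Matrix.toEuclideanLin A) (by
      intro x y
      have h := LinearMap.adjoint_inner_left (Matrix.toEuclideanLin A) y x
      rw [← Matrix.toEuclideanLin_conjTranspose_eq_adjoint] at h
      have hA' : A.conjTranspose = -A := by
        rw [Matrix.conjTranspose_eq_transpose_of_trivial, hA]
      rw [hA', map_neg, LinearMap.neg_apply, inner_neg_left] at h
      linarith)
  let s : Equiv.Perm (Fin n) := Tuple.sort (fun j => -mu j)
  have hs : Monotone ((fun j => -mu j) ∘ s) := Tuple.monotone_sort _
  refine ⟨b.reindex ((Equiv.refl _).prodCongr s.symm), mu ∘ s, ?_, fun j => hmu _, ?_⟩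
  · intro i j hij
    have := hs hij
    simp only [Function.comp_apply] at this ⊢
    linarith
  · rintro ⟨i, j⟩ ⟨i', j'⟩
    have h2 := orthonormal_iff_ite.1 b.orthonormal
    have key : ∀ q q', inner ℝ (b q) (b q') = if q = q' then (1 : ℝ) else 0 := h2
    simp only [OrthonormalBasis.reindex_apply, Matrix.blockDiagonal_apply, Function.comp_apply]
    simp only [Equiv.prodCongr_symm, Equiv.refl_symm, Equiv.symm_symm, Equiv.prodCongr_apply,
      Equiv.coe_refl, Prod.map_apply, id_eq]
    fin_cases i'
    · simp only [Fin.zero_eta, (hb _).1, inner_smul_right, key]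
      fin_cases i <;> by_cases h : j = j' <;> simp [h]
    · simp only [Fin.mk_one, (hb _).2, inner_neg_right, inner_smul_right, key]
      fin_cases i <;> by_cases h : j = j' <;> simp [h]

/-- Every real skew-symmetric matrix of even size has a normalizing orthonormal basis. -/
theorem nonempty_normalFrame {n : ℕ} (A : Matrix (Fin (2 * n)) (Fin (2 * n)) ℝ)
    (hA : A.transpose = -A) : Nonempty (NormalFrame A) := by
  obtain ⟨b, mu, h1, h2, h3⟩ := exists_antitone_basis A hA
  exact ⟨⟨b, mu, h1, h2, h3⟩⟩

/-- On a non-degenerate group a family of normalizing bases exists, one for each `τ`. -/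
theorem IsNondegenerate.nonempty_normalFrames {n r : ℕ}
    {B : Fin r → Matrix (Fin (2 * n)) (Fin (2 * n)) ℝ} (hB : IsNondegenerate B) :
    Nonempty (∀ τ : Centre r, NormalFrame (BTau B τ)) := by
  refine ⟨fun τ => Classical.choice (nonempty_normalFrame _ ?_)⟩
  simp [BTau, Matrix.transpose_sum, hB.skew]

/-- The Laguerre polynomial `L_k = L_k^{(0)}`. -/
def laguerre (k : ℕ) (s : ℝ) : ℝ :=
  ∑ i ∈ Finset.range (k + 1), (-1) ^ i * (k.choose i : ℝ) / (i.factorial : ℝ) * s ^ i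

/-- The Laguerre function `l_k^{(0)}(σ) = L_k^{(0)}(σ) e^{-σ/2}`. -/
def laguerreFun (k : ℕ) (s : ℝ) : ℝ := laguerre k s * Real.exp (-s / 2)

/-- The partial Fourier transform of the Laguerre distribution of degree `k` and order `0` on
`ℝ² × ℝ^r`, namely `(2|τ|/π) l_k^{(0)}(2|τ||y|²)`. -/
def laguerreTilde₂ {r : ℕ} (k : ℕ) (y : EuclideanSpace ℝ (Fin 2)) (τ : Centre r) : ℝ :=
  2 * ‖τ‖ / Real.pi * laguerreFun k (2 * ‖τ‖ * ‖y‖ ^ 2)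

/-- The direction `τ / |τ|`. -/
def dir {r : ℕ} (τ : Centre r) : Centre r := ‖τ‖⁻¹ • τ

section Kernel

variable {n r : ℕ} {B : Fin r → Matrix (Fin (2 * n)) (Fin (2 * n)) ℝ}

/-- The pair `y_j^τ = (y_{2j-1}^τ, y_{2j}^τ)` of `τ`-coordinates of `y`, with respect to the
basis that normalizes `B^τ`. -/
def tauCoord (F : ∀ ω : Centre r, NormalFrame (BTau B ω)) (y : Horiz n) (τ : Centre r)
    (j : Fin n) : EuclideanSpace ℝ (Fin 2) :=
  !₂[(F (dir τ)).basis.repr y (0, j), (F (dir τ)).basis.repr y (1, j)]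

/-- The partial Fourier transform of the exponential Laguerre distribution of degree
`k = (k_1, …, k_n)` and order `0`. -/
def laguerreTilde (F : ∀ ω : Centre r, NormalFrame (BTau B ω)) (k : Fin n → ℕ)
    (y : Horiz n) (τ : Centre r) : ℝ :=
  ∏ j, (F (dir τ)).mu j *
    laguerreTilde₂ (k j) (Real.sqrt ((F (dir τ)).mu j) • tauCoord F y τ j) τ

/-- `Q_m(y, τ)`, the sum over all multi-indices `k` with `k_1 + ⋯ + k_n = m`. -/
def Qm (F : ∀ ω : Centre r, NormalFrame (BTau B ω)) (m : ℕ) (y : Horiz n) (τ : Centre r) : ℝ :=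
  ∑ k ∈ Finset.piAntidiag (Finset.univ : Finset (Fin n)) m, laguerreTilde F k y τ

/-- The inverse partial Fourier transform of `Q_m`; the integral converges for `y ≠ 0`. -/
def PmAux (F : ∀ ω : Centre r, NormalFrame (BTau B ω)) (m : ℕ) (x : Space n r) : ℂ :=
  1 / (2 * Real.pi : ℂ) ^ r *
    ∫ τ : Centre r, Complex.exp (Complex.I * (inner ℝ x.2 τ : ℝ)) * (Qm F m x.1 τ : ℂ)

open Classical in
/-- The kernel `P_m`: the inverse partial Fourier transform of `Q_m` where `y ≠ 0`, and its
extension by continuity to the points `(0, t)`, `t ≠ 0`. The value at the origin is irrelevant. -/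
def Pm (F : ∀ ω : Centre r, NormalFrame (BTau B ω)) (m : ℕ) (x : Space n r) : ℂ :=
  if x.1 ≠ 0 then PmAux F m x
  else limUnder (𝓝[{p : Space n r | p.1 ≠ 0}] x) (PmAux F m)

/-- The partial Fourier transform `φ̃(y, τ) = ∫ e^{-i τ·t} φ(y, t) dt`. -/
def partialFourier (φ : 𝓢(Space n r, ℂ)) (y : Horiz n) (τ : Centre r) : ℂ :=
  ∫ t : Centre r, Complex.exp (-Complex.I * (inner ℝ τ t : ℝ)) * φ (y, t)

/-- The integrand `Q_m(y, τ) φ̃(y, -τ)` of the pairing of `𝒫_m` with `φ`. -/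
def pairingIntegrand (F : ∀ ω : Centre r, NormalFrame (BTau B ω)) (m : ℕ)
    (φ : 𝓢(Space n r, ℂ)) (p : Space n r) : ℂ :=
  (Qm F m p.1 p.2 : ℂ) * partialFourier φ p.1 (-p.2)

/-- The pairing `⟨𝒫_m, φ⟩ = (2π)^{-r} ∫ Q_m(y, τ) φ̃(y, -τ) dy dτ`. -/
def pairing (F : ∀ ω : Centre r, NormalFrame (BTau B ω)) (m : ℕ) (φ : 𝓢(Space n r, ℂ)) : ℂ :=
  1 / (2 * Real.pi : ℂ) ^ r * ∫ p : Space n r, pairingIntegrand F m φ p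

end Kernel

/-- The homogeneous norm `(|y|⁴ + |t|²)^{1/4}`. -/
def homNorm {n r : ℕ} (x : Space n r) : ℝ := (‖x.1‖ ^ 4 + ‖x.2‖ ^ 2) ^ (1 / 4 : ℝ)

/-- The closed homogeneous ball `B(0, ε)`. -/
def homBall (n r : ℕ) (ε : ℝ) : Set (Space n r) := {x | homNorm x ≤ ε}

/-- The homogeneous unit sphere `∂B(0, 1)`. -/
def homSphere (n r : ℕ) : Set (Space n r) := {x | homNorm x = 1}

/-- The dilation `δ_c(y, t) = (c y, c² t)`. -/
def dil {n r : ℕ} (c : ℝ) (x : Space n r) : Space n r := (c • x.1, c ^ 2 • x.2)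

/-- The surface measure `σ` on the homogeneous unit sphere that belongs to the dilations, i.e. the
one in the polar coordinates `∫ f(x) dx = ∫₀^∞ ∫ f(δ_s ω) s^{Q-1} dσ(ω) ds` with `Q = 2n + 2r`.
Thus `σ(E)` is `Q` times the volume of the cone `{δ_s ω : ω ∈ E, 0 < s ≤ 1}` over `E`. It is
regarded as a measure on the whole space, carried by the sphere. -/
def sphereMeasure (n r : ℕ) : Measure (Space n r) :=
  ((2 * n + 2 * r : ℕ) : ℝ≥0∞) •
    ((volume.restrict (homBall n r 1)).map fun x => dil (homNorm x)⁻¹ x)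

end StepTwo

end

open StepTwo

/-! ### Generating series and the addition formula for Laguerre polynomials -/

namespace StepTwo

/-! The frames enter only through the operator |B^τ|. By the addition formula for Laguerre
polynomials, the sum over |k| = m of ∏ L_{k_j}(σ_j) is a polynomial in ∑ σ_j. Half of ∑ σ_j is q =
⟨|B^τ|y, y⟩ and the product of the |τ|μ_j is √det B^τ, so Q_m(y, τ) = √det B^τ · p(q) e^{-q} for a
fixed polynomial p (`exists_Qm_eq`). Now |B^τ| is the positive square root of -(B^τ)², which the
inverse function theorem shows to be smooth off τ = 0, however irregularly the frames are chosen
(`contDiffAt_absOp`). Thus Q_m is smooth off τ = 0, homogeneous, and bounded by C|τ|^n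
e^{-c|τ||y|²}.

No pointwise bound on P_m near y = 0 is needed, only integrability over one homogeneous shell. Cut
Q_m dyadically in τ. The piece on a fixed annulus has an integrable inverse Fourier transform K₀, by
integration by parts in τ. The other pieces are the L¹-normalised dilates of K₀, so the mass of P_m
on the shell 1 < |x| ≤ 2 is at most the sum of the masses of K₀ on disjoint dyadic shells, hence at
most ‖K₀‖₁ (`lintegral_shell_PmAux_lt_top`).

Since P_m is homogeneous of degree -(2n+2r), this makes φ P_m integrable outside every ball and (φ -
φ(0)) P_m integrable on small balls, with integral tending to 0. Fubini in each fibre y ≠ 0 gives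
⟨𝒫_m, φ⟩ = ∫ dy ∫ dt φ P_m as an iterated integral. Splitting it at homogeneous radius ε leaves φ(0)
times the iterated integral of P_m over the ball, which by dilation does not depend on ε; this
number is C (`iterated_integral_eq`). Comparing two radii shows that shell integrals of P_m vanish
(`integral_shell_eq_zero`), and a radial layer-cake argument turns this into mean value zero on the
sphere (`IsCriticalKernel.sphere`). The plane y = 0 is null for both measures involved, so the
values of P_m there play no role. -/

theorem sum_range_choose_right (k l : ℕ) :
    ∑ i ∈ Finset.range k, i.choose l = k.choose (l + 1) := by
  induction k with
  | zero => simp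
  | succ k ih => rw [Finset.sum_range_succ, ih, Nat.choose_succ_succ, add_comm]

/-- Comparison of coefficients reduces this to the hockey-stick identity. It is the linear
differential equation for the generating series, read coefficientwise. -/
theorem hasDerivAt_laguerre (k : ℕ) (s : ℝ) :
    HasDerivAt (laguerre k) (-∑ i ∈ Finset.range k, laguerre i s) s := by
  have h1 : HasDerivAt (laguerre k) (∑ i ∈ Finset.range (k + 1),
      (-1) ^ i * (k.choose i : ℝ) / (i.factorial : ℝ) * (i * s ^ (i - 1))) s := by
    unfold laguerre
    refine HasDerivAt.fun_sum fun i _ => ?_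
    exact (hasDerivAt_pow i s).const_mul _
  convert h1 using 1
  rw [Finset.sum_range_succ']
  have h2 : ∀ i ∈ Finset.range k, laguerre i s =
      ∑ l ∈ Finset.range k, (-1) ^ l * (i.choose l : ℝ) / (l.factorial : ℝ) * s ^ l := by
    intro i hi
    refine Finset.sum_subset (by simpa using hi) fun l _ hl => ?_
    have : i < l := by simpa [Nat.lt_succ_iff] using hl
    simp [Nat.choose_eq_zero_of_lt this]
  rw [Finset.sum_congr rfl h2, Finset.sum_comm]
  simp only [CharP.cast_eq_zero, zero_mul, mul_zero, add_zero]
  rw [← Finset.sum_neg_distrib]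
  refine Finset.sum_congr rfl fun l _ => ?_
  have h3 : ∑ i ∈ Finset.range k, ((i.choose l : ℕ) : ℝ) = (k.choose (l + 1) : ℝ) := by
    rw [← Nat.cast_sum, sum_range_choose_right]
  have h4 : ((l + 1).factorial : ℝ) = (l + 1) * l.factorial := by
    rw [Nat.factorial_succ]; push_cast; ring
  have h5 : (l.factorial : ℝ) ≠ 0 := by positivity
  rw [← h3, h4, Finset.mul_sum, Finset.sum_div, Finset.sum_mul, ← Finset.sum_neg_distrib]
  refine Finset.sum_congr rfl fun i _ => ?_
  push_cast
  have h6 : (l : ℝ) + 1 ≠ 0 := by positivity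
  field_simp
  ring

theorem laguerre_eq_eval (k : ℕ) : ∃ p : Polynomial ℝ, ∀ s, laguerre k s = p.eval s :=
  ⟨∑ i ∈ Finset.range (k + 1),
    Polynomial.C ((-1) ^ i * (k.choose i : ℝ) / (i.factorial : ℝ)) * Polynomial.X ^ i, fun s => by
    simp [laguerre, Polynomial.eval_finsetSum]⟩

/-- The generating series of the Laguerre polynomials. -/
noncomputable def laguerreSeries (s : ℝ) : PowerSeries ℝ := PowerSeries.mk fun k => laguerre k s

theorem laguerre_zero_right (k : ℕ) : laguerre k 0 = 1 := by
  simp [laguerre, Finset.sum_range_succ']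

/-- As `PowerSeries.mk 1` is 1/(1 - X), the generating series G satisfies ∂G/∂s = -X/(1 - X) · G. -/
theorem hasDerivAt_coeff_laguerreSeries (k : ℕ) (s : ℝ) :
    HasDerivAt (fun s => PowerSeries.coeff k (laguerreSeries s))
      (PowerSeries.coeff k (-(PowerSeries.X * PowerSeries.mk 1) * laguerreSeries s)) s := by
  have h1 : PowerSeries.coeff k (-(PowerSeries.X * PowerSeries.mk 1) * laguerreSeries s)
      = -∑ i ∈ Finset.range k, laguerre i s := by
    rw [neg_mul, map_neg, mul_assoc]
    congr 1
    cases k with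
    | zero => simp
    | succ k =>
      rw [PowerSeries.coeff_succ_X_mul, mul_comm, PowerSeries.coeff_mul,
        Finset.Nat.sum_antidiagonal_eq_sum_range_succ_mk]
      simp [laguerreSeries]
  rw [h1]
  simpa [laguerreSeries] using! hasDerivAt_laguerre k s

/-- Both factors of G(t) G(x + y - t) solve the same linear equation, in opposite directions of t,
so each coefficient of the product is constant in t. Compare t = x with t = x + y. This replaces the
closed form of G. -/
theorem laguerreSeries_mul (x y : ℝ) :
    laguerreSeries x * laguerreSeries y = laguerreSeries (x + y) * laguerreSeries 0 := by
  ext k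
  set u : PowerSeries ℝ := -(PowerSeries.X * PowerSeries.mk 1)
  have h : ∀ t, HasDerivAt (fun t => PowerSeries.coeff k
      (laguerreSeries t * laguerreSeries (x + y - t))) 0 t := by
    intro t
    have h1 : HasDerivAt (fun t => ∑ p ∈ Finset.HasAntidiagonal.antidiagonal k,
        PowerSeries.coeff p.1 (laguerreSeries t) *
          PowerSeries.coeff p.2 (laguerreSeries (x + y - t)))
        (∑ p ∈ Finset.HasAntidiagonal.antidiagonal k,
          (PowerSeries.coeff p.1 (u * laguerreSeries t) *
            PowerSeries.coeff p.2 (laguerreSeries (x + y - t)) +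
          PowerSeries.coeff p.1 (laguerreSeries t) *
            (PowerSeries.coeff p.2 (u * laguerreSeries (x + y - t)) * -1))) t := by
      refine HasDerivAt.fun_sum fun p _ => ?_
      refine (hasDerivAt_coeff_laguerreSeries p.1 t).mul ?_
      exact (hasDerivAt_coeff_laguerreSeries p.2 (x + y - t)).comp t
        (by simpa using (hasDerivAt_id t).const_sub (x + y))
    simp only [PowerSeries.coeff_mul k]
    convert h1 using 1
    rw [Finset.sum_add_distrib, ← PowerSeries.coeff_mul]
    simp only [mul_neg, mul_one, Finset.sum_neg_distrib]
    rw [← PowerSeries.coeff_mul]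
    rw [show u * laguerreSeries t * laguerreSeries (x + y - t) =
      laguerreSeries t * (u * laguerreSeries (x + y - t)) by ring]
    ring
  have h2 := is_const_of_deriv_eq_zero (fun t => (h t).differentiableAt) (fun t => (h t).deriv)
    x (x + y)
  simpa using h2

/-- The factor G(0) on the left avoids the exponent `s.card - 1` and covers the empty product. -/
theorem prod_laguerreSeries {ι : Type*} (s : Finset ι) (x : ι → ℝ) :
    laguerreSeries 0 * ∏ j ∈ s, laguerreSeries (x j) =
      laguerreSeries (∑ j ∈ s, x j) * laguerreSeries 0 ^ s.card := by
  classical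
  induction s using Finset.induction_on with
  | empty => simp
  | insert a s ha ih =>
    rw [Finset.prod_insert ha, Finset.sum_insert ha, Finset.card_insert_of_notMem ha, mul_left_comm,
      ih, ← mul_assoc, laguerreSeries_mul, pow_succ]
    ring

/-- The addition formula: the sum over `|k| = m` of `∏ L_{k_j}(x_j)` is a polynomial in `∑ x_j`. -/
theorem exists_sum_prod_laguerre (n m : ℕ) : ∃ p : Polynomial ℝ, ∀ x : Fin n → ℝ,
    ∑ k ∈ Finset.piAntidiag (Finset.univ : Finset (Fin n)) m, ∏ j, laguerre (k j) (x j) =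
      p.eval (∑ j, x j) := by
  choose P hP using laguerre_eq_eval
  -- Since G(0) = 1/(1 - X), this is (1 - X)^{1-n}, written so that n = 0 is allowed. It does not
  -- depend on x, hence the m-th coefficient of G(∑ x_j) w is a polynomial in ∑ x_j.
  set w : PowerSeries ℝ := (1 - PowerSeries.X) * laguerreSeries 0 ^ n
  refine ⟨∑ q ∈ Finset.HasAntidiagonal.antidiagonal m, P q.1 * Polynomial.C (PowerSeries.coeff q.2 w), fun x => ?_⟩
  have h0 : (1 - PowerSeries.X) * laguerreSeries 0 = 1 := by
    have : laguerreSeries 0 = PowerSeries.mk 1 := by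
      ext k; simp [laguerreSeries, laguerre_zero_right]
    rw [this, mul_comm]
    exact PowerSeries.mk_one_mul_one_sub_eq_one ℝ
  have h1 := prod_laguerreSeries Finset.univ x
  have h2 : ∏ j, laguerreSeries (x j) = laguerreSeries (∑ j, x j) * w := by
    have := congrArg (fun z => (1 - PowerSeries.X) * z) h1
    simp only [← mul_assoc, h0, one_mul, Finset.card_univ, Fintype.card_fin] at this
    rw [this]; ring
  have h3 := congrArg (PowerSeries.coeff m) h2
  rw [PowerSeries.coeff_prod, PowerSeries.coeff_mul] at h3
  simp only [Polynomial.eval_finsetSum, Polynomial.eval_mul, Polynomial.eval_C, ← hP]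
  simp only [laguerreSeries, PowerSeries.coeff_mk] at h3 ⊢
  rw [← h3]
  refine (Finset.sum_equiv Finsupp.equivFunOnFinite ?_ ?_).symm
  · intro f; simp [Finset.mem_finsuppAntidiag]
  · intro f _; rfl

end StepTwo

/-! ### The operator |B^τ| and the closed form of Q_m -/

namespace StepTwo

noncomputable section

variable {n r : ℕ} {B : Fin r → Matrix (Fin (2 * n)) (Fin (2 * n)) ℝ}

/-- The map `τ ↦ B^τ` as a continuous linear map into the operators on the first layer. -/
def BOp (B : Fin r → Matrix (Fin (2 * n)) (Fin (2 * n)) ℝ) :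
    Centre r →L[ℝ] (Horiz n →L[ℝ] Horiz n) :=
  LinearMap.toContinuousLinearMap
    { toFun := fun τ => LinearMap.toContinuousLinearMap (Matrix.toEuclideanLin (BTau B τ))
      map_add' := fun x y => by
        simp [BTau, add_smul, Finset.sum_add_distrib, map_add]
      map_smul' := fun c x => by
        simp only [BTau, PiLp.smul_apply, smul_eq_mul, RingHom.id_apply, mul_smul,
          ← Finset.smul_sum, map_smul] }

theorem BOp_apply (τ : Centre r) (v : Horiz n) :
    BOp B τ v = Matrix.toEuclideanLin (BTau B τ) v := rfl

theorem norm_smul_dir (τ : Centre r) : ‖τ‖ • dir τ = τ := by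
  by_cases h : τ = 0
  · simp [h]
  · rw [dir, smul_smul, mul_inv_cancel₀ (by simpa using h), one_smul]

theorem norm_dir {τ : Centre r} (h : τ ≠ 0) : ‖dir τ‖ = 1 := by
  rw [dir, norm_smul, norm_inv, norm_norm, inv_mul_cancel₀ (by simpa using h)]

theorem dir_smul {c : ℝ} (hc : 0 < c) (τ : Centre r) : dir (c • τ) = dir τ := by
  rw [dir, dir, norm_smul, Real.norm_of_nonneg hc.le, smul_smul]
  congr 1
  field_simp

theorem BOp_basis_zero (τ : Centre r) (G : NormalFrame (BTau B τ)) (j : Fin n) :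
    BOp B τ (G.basis (0, j)) = G.mu j • G.basis (1, j) := by
  refine InnerProductSpace.ext_inner_left_basis G.basis.toBasis fun q => ?_
  obtain ⟨i, j'⟩ := q
  have h2 := orthonormal_iff_ite.1 G.basis.orthonormal
  simp only [OrthonormalBasis.coe_toBasis, BOp_apply, G.normal, inner_smul_right,
    Matrix.blockDiagonal_apply, h2]
  fin_cases i <;> by_cases h : j' = j <;> simp [h]

theorem BOp_basis_one (τ : Centre r) (G : NormalFrame (BTau B τ)) (j : Fin n) :
    BOp B τ (G.basis (1, j)) = -(G.mu j • G.basis (0, j)) := by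
  refine InnerProductSpace.ext_inner_left_basis G.basis.toBasis fun q => ?_
  obtain ⟨i, j'⟩ := q
  have h2 := orthonormal_iff_ite.1 G.basis.orthonormal
  simp only [OrthonormalBasis.coe_toBasis, BOp_apply, G.normal, inner_smul_right, inner_neg_right,
    Matrix.blockDiagonal_apply, h2]
  fin_cases i <;> by_cases h : j' = j <;> simp [h]

/-- The numbers `|τ| μ_j(τ/|τ|)`, which are the singular values of `B^τ`. -/
def specVal (F : ∀ ω : Centre r, NormalFrame (BTau B ω)) (τ : Centre r) (j : Fin n) : ℝ :=
  ‖τ‖ * (F (dir τ)).mu j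

/-- The operator `|B^τ|`. -/
def absOp (F : ∀ ω : Centre r, NormalFrame (BTau B ω)) (τ : Centre r) : Horiz n →L[ℝ] Horiz n :=
  ∑ q, specVal F τ q.2 •
    (innerSL ℝ ((F (dir τ)).basis q)).smulRight ((F (dir τ)).basis q)

/-- The quadratic form of `|B^τ|`, in the coordinates of the normalizing basis. -/
def quad (F : ∀ ω : Centre r, NormalFrame (BTau B ω)) (y : Horiz n) (τ : Centre r) : ℝ :=
  ∑ j, specVal F τ j * ‖tauCoord F y τ j‖ ^ 2

variable (F : ∀ ω : Centre r, NormalFrame (BTau B ω))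

theorem specVal_nonneg (τ : Centre r) (j : Fin n) : 0 ≤ specVal F τ j :=
  mul_nonneg (norm_nonneg _) ((F (dir τ)).mu_nonneg j)

theorem absOp_basis (τ : Centre r) (q : Fin 2 × Fin n) :
    absOp F τ ((F (dir τ)).basis q) = specVal F τ q.2 • (F (dir τ)).basis q := by
  have h2 := orthonormal_iff_ite.1 (F (dir τ)).basis.orthonormal
  simp [absOp, h2]

theorem BOp_spec_zero (τ : Centre r) (j : Fin n) :
    BOp B τ ((F (dir τ)).basis (0, j)) = specVal F τ j • (F (dir τ)).basis (1, j) := by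
  have h : BOp B τ = ‖τ‖ • BOp B (dir τ) := by rw [← map_smul, norm_smul_dir]
  rw [h, smul_apply, BOp_basis_zero, smul_smul, specVal]

theorem BOp_spec_one (τ : Centre r) (j : Fin n) :
    BOp B τ ((F (dir τ)).basis (1, j)) = -(specVal F τ j • (F (dir τ)).basis (0, j)) := by
  have h : BOp B τ = ‖τ‖ • BOp B (dir τ) := by rw [← map_smul, norm_smul_dir]
  rw [h, smul_apply, BOp_basis_one, smul_neg, smul_smul, specVal]

/-- On each normalizing vector both sides are multiplication by the squared singular value. The
right side is a polynomial in τ that knows nothing of the frame; all regularity of `absOp` comes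
from this identity together with positivity. -/
theorem absOp_mul_self (τ : Centre r) :
    absOp F τ * absOp F τ = -(BOp B τ * BOp B τ) := by
  refine ContinuousLinearMap.coe_injective ((F (dir τ)).basis.toBasis.ext fun q => ?_)
  obtain ⟨i, j⟩ := q
  have h : i = 0 ∨ i = 1 := by fin_cases i <;> simp
  rcases h with rfl | rfl <;>
  simp [absOp_basis, BOp_spec_zero, BOp_spec_one]

theorem inner_absOp_self (τ : Centre r) (y : Horiz n) :
    inner ℝ (absOp F τ y) y = quad F y τ := by
  simp only [absOp, sum_apply, smul_apply,
    ContinuousLinearMap.smulRight_apply, innerSL_apply_apply, sum_inner, inner_smul_left,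
    quad, tauCoord, OrthonormalBasis.repr_apply_apply]
  rw [Fintype.sum_prod_type, Fin.sum_univ_two, ← Finset.sum_add_distrib]
  refine Finset.sum_congr rfl fun j _ => ?_
  simp [EuclideanSpace.norm_sq_eq, Fin.sum_univ_two]
  ring

theorem quad_nonneg (y : Horiz n) (τ : Centre r) : 0 ≤ quad F y τ :=
  Finset.sum_nonneg fun j _ => mul_nonneg (specVal_nonneg F τ j) (sq_nonneg _)

theorem sum_norm_tauCoord (y : Horiz n) (τ : Centre r) :
    ∑ j, ‖tauCoord F y τ j‖ ^ 2 = ‖y‖ ^ 2 := by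
  have h : ‖y‖ ^ 2 = ∑ q, ((F (dir τ)).basis.repr y q) ^ 2 := by
    rw [← (F (dir τ)).basis.repr.norm_map y, EuclideanSpace.norm_sq_eq]
    simp
  rw [h, Fintype.sum_prod_type, Fin.sum_univ_two, ← Finset.sum_add_distrib]
  refine Finset.sum_congr rfl fun j _ => ?_
  simp [tauCoord, EuclideanSpace.norm_sq_eq, Fin.sum_univ_two]

/-- The Laguerre sum only depends on `|B^τ|`, through its quadratic form and its determinant. -/
theorem exists_Qm_eq (n m : ℕ) : ∃ p : Polynomial ℝ, ∀ {r : ℕ}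
    {B : Fin r → Matrix (Fin (2 * n)) (Fin (2 * n)) ℝ} (F : ∀ ω : Centre r, NormalFrame (BTau B ω))
    (y : Horiz n) (τ : Centre r), Qm F m y τ =
      (∏ j, specVal F τ j) * (p.eval (quad F y τ) * Real.exp (-quad F y τ)) := by
  obtain ⟨p, hp⟩ := exists_sum_prod_laguerre n m
  -- Each σ_j equals 2 · `specVal` · |y_j|², so ∑ σ_j is twice the quadratic form and the factors
  -- e^{-σ_j/2} multiply to exp(-`quad`). Each j contributes one factor 2/π.
  refine ⟨Polynomial.C ((2 / Real.pi) ^ n) * p.comp (Polynomial.C 2 * Polynomial.X),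
    fun F y τ => ?_⟩
  have h1 : ∀ k : Fin n → ℕ, laguerreTilde F k y τ =
      (2 / Real.pi) ^ n * (∏ j, specVal F τ j) *
        Real.exp (-quad F y τ) *
        (∏ j, laguerre (k j) (2 * (specVal F τ j * ‖tauCoord F y τ j‖ ^ 2))) := by
    intro k
    have h2 : Real.exp (-quad F y τ) =
        ∏ j, Real.exp (-(specVal F τ j * ‖tauCoord F y τ j‖ ^ 2)) := by
      rw [← Real.exp_sum, quad, Finset.sum_neg_distrib]
    have h3 : (2 / Real.pi) ^ n = ∏ _j : Fin n, (2 / Real.pi) := by simp [div_pow]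
    rw [h2, h3, ← Finset.prod_mul_distrib, ← Finset.prod_mul_distrib, ← Finset.prod_mul_distrib]
    refine Finset.prod_congr rfl fun j _ => ?_
    have h4 : ‖Real.sqrt ((F (dir τ)).mu j) • tauCoord F y τ j‖ ^ 2 =
        (F (dir τ)).mu j * ‖tauCoord F y τ j‖ ^ 2 := by
      rw [norm_smul, mul_pow, Real.norm_of_nonneg (Real.sqrt_nonneg _),
        Real.sq_sqrt ((F (dir τ)).mu_nonneg j)]
    rw [laguerreTilde₂, laguerreFun, h4, specVal]
    rw [show 2 * ‖τ‖ * ((F (dir τ)).mu j * ‖tauCoord F y τ j‖ ^ 2) =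
      2 * (‖τ‖ * (F (dir τ)).mu j * ‖tauCoord F y τ j‖ ^ 2) by ring]
    rw [show -(2 * (‖τ‖ * (F (dir τ)).mu j * ‖tauCoord F y τ j‖ ^ 2)) / 2 =
      -(‖τ‖ * (F (dir τ)).mu j * ‖tauCoord F y τ j‖ ^ 2) by ring]
    ring
  simp only [Qm, h1, ← Finset.mul_sum]
  rw [hp, ← Finset.mul_sum]
  simp only [Polynomial.eval_mul, Polynomial.eval_C, Polynomial.eval_comp, Polynomial.eval_X, quad]
  ring

theorem specVal_le (τ : Centre r) (j : Fin n) : specVal F τ j ≤ ‖BOp B‖ * ‖τ‖ := by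
  have h1 : ‖BOp B τ ((F (dir τ)).basis (0, j))‖ = specVal F τ j := by
    rw [BOp_spec_zero, norm_smul, (F (dir τ)).basis.norm_eq_one, mul_one,
      Real.norm_of_nonneg (specVal_nonneg F τ j)]
  rw [← h1]
  refine ((BOp B τ).le_opNorm _).trans ?_
  rw [(F (dir τ)).basis.norm_eq_one, mul_one]
  exact (BOp B).le_opNorm τ

/-- For τ ≠ 0, μ_j(τ/|τ|) is the length of the image of a unit vector under B^{τ/|τ|}. On the
compact product of unit spheres that length has a positive lower bound because every such matrix is
invertible; the bound is therefore the same for all frames. -/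
theorem IsNondegenerate.exists_le_specVal (hB : IsNondegenerate B) :
    ∃ c > 0, ∀ (F : ∀ ω : Centre r, NormalFrame (BTau B ω)) (τ : Centre r) (j : Fin n),
      c * ‖τ‖ ≤ specVal F τ j := by
  have hK : IsCompact (Metric.sphere (0 : Centre r) 1 ×ˢ Metric.sphere (0 : Horiz n) 1) :=
    (isCompact_sphere _ _).prod (isCompact_sphere _ _)
  obtain ⟨c, hc, h⟩ := hK.exists_forall_le' (f := fun p => ‖BOp B p.1 p.2‖) (a := 0)
    (by fun_prop) (by
      rintro ⟨τ, v⟩ ⟨h1, h2⟩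
      have h1' : τ ≠ 0 := by rintro rfl; simp at h1
      have h2' : v ≠ 0 := by rintro rfl; simp at h2
      rw [norm_pos_iff]
      intro h3
      apply h2'
      have h4 : (BTau B τ).mulVec v.ofLp = 0 := by
        have := congrArg WithLp.ofLp h3
        simpa [BOp_apply, Matrix.toLpLin_apply] using this
      have := Matrix.eq_zero_of_mulVec_eq_zero (hB.det_ne_zero τ h1') h4
      ext i
      exact congrFun this i)
  refine ⟨c, hc, fun F τ j => ?_⟩
  by_cases h0 : τ = 0
  · simp [h0, specVal]
  have h1 := h (dir τ, (F (dir τ)).basis (0, j)) ⟨by simpa using norm_dir h0, by simp⟩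
  simp only [BOp_basis_zero, norm_smul, (F (dir τ)).basis.norm_eq_one, mul_one] at h1
  rw [Real.norm_of_nonneg ((F (dir τ)).mu_nonneg j)] at h1
  rw [specVal, mul_comm]
  gcongr

theorem le_quad {c : ℝ} (hc : ∀ (τ : Centre r) (j : Fin n), c * ‖τ‖ ≤ specVal F τ j)
    (y : Horiz n) (τ : Centre r) : c * ‖τ‖ * ‖y‖ ^ 2 ≤ quad F y τ := by
  rw [← sum_norm_tauCoord F y τ, Finset.mul_sum]
  exact Finset.sum_le_sum fun j _ => by gcongr; exact hc τ j

/-- The determinant is the square of the product of the singular values, which come in equal pairs.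
The individual values need not be smooth in τ, but the square root of a nonvanishing polynomial is.
-/
theorem prod_specVal_eq (τ : Centre r) :
    ∏ j, specVal F τ j = Real.sqrt (BTau B τ).det := by
  have h1 : (BTau B (dir τ)).det = ∏ j, (F (dir τ)).mu j ^ 2 := by
    have h2 : LinearMap.toMatrix (F (dir τ)).basis.toBasis (F (dir τ)).basis.toBasis
        (Matrix.toEuclideanLin (BTau B (dir τ))) =
        Matrix.blockDiagonal (fun j => !![0, -(F (dir τ)).mu j; (F (dir τ)).mu j, 0]) := by
      ext a b
      rw [← (F (dir τ)).normal, LinearMap.toMatrix_apply, OrthonormalBasis.coe_toBasis_repr_apply,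
        OrthonormalBasis.repr_apply_apply, OrthonormalBasis.coe_toBasis]
    have h3 : LinearMap.det (Matrix.toEuclideanLin (BTau B (dir τ))) = (BTau B (dir τ)).det := by
      rw [Matrix.toEuclideanLin_eq_toLin_orthonormal, LinearMap.det_toLin]
    rw [← h3, ← LinearMap.det_toMatrix (F (dir τ)).basis.toBasis, h2, Matrix.det_blockDiagonal]
    refine Finset.prod_congr rfl fun j _ => ?_
    simp [Matrix.det_fin_two]
    ring
  have h4 : BTau B τ = ‖τ‖ • BTau B (dir τ) := by
    conv_lhs => rw [← norm_smul_dir τ]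
    simp only [BTau, PiLp.smul_apply, smul_eq_mul, mul_smul, Finset.smul_sum]
  have h5 : (BTau B τ).det = (∏ j, specVal F τ j) ^ 2 := by
    rw [h4, Matrix.det_smul, h1, Fintype.card_fin]
    simp only [specVal, Finset.prod_mul_distrib, Finset.prod_const, Finset.card_univ,
      Fintype.card_fin, Finset.prod_pow]
    ring
  rw [h5, Real.sqrt_sq (Finset.prod_nonneg fun j _ => specVal_nonneg F τ j)]

end

end StepTwo

/-! ### Smoothness of |B^τ| away from τ = 0 -/

namespace StepTwo

noncomputable section

variable {n r : ℕ} {B : Fin r → Matrix (Fin (2 * n)) (Fin (2 * n)) ℝ}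
variable (F : ∀ ω : Centre r, NormalFrame (BTau B ω))

/-- Write S = |B^τ|, S₀ = |B^{τ₀}|, and let b be an eigenvector of S₀ with eigenvalue l. From S² -
S₀² = S(S - S₀) + (S - S₀)S₀, the vector h = (S - S₀)b solves Sh + lh = (S² - S₀²)b. Pairing with h
and using S ≥ 0 bounds l‖h‖. Only the frame at τ₀ is used as a test basis, so no continuity of
frames is required. -/
theorem norm_absOp_sub_basis_le (τ₀ τ : Centre r) (q : Fin 2 × Fin n)
    (hq : 0 < specVal F τ₀ q.2) :
    ‖(absOp F τ - absOp F τ₀) ((F (dir τ₀)).basis q)‖ ≤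
      ‖(BOp B τ * BOp B τ - BOp B τ₀ * BOp B τ₀) ((F (dir τ₀)).basis q)‖ / specVal F τ₀ q.2 := by
  set b := (F (dir τ₀)).basis q
  set l := specVal F τ₀ q.2
  set h := (absOp F τ - absOp F τ₀) b with hh
  have e1 : absOp F τ h + l • h = -((BOp B τ * BOp B τ - BOp B τ₀ * BOp B τ₀) b) := by
    have e2 : absOp F τ * absOp F τ - absOp F τ₀ * absOp F τ₀ =
        -(BOp B τ * BOp B τ - BOp B τ₀ * BOp B τ₀) := by
      rw [absOp_mul_self, absOp_mul_self]; abel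
    rw [← neg_apply, ← e2]
    have e3 : absOp F τ₀ b = l • b := absOp_basis F τ₀ q
    simp only [hh, sub_apply, mul_apply_eq_comp, e3, map_sub, map_smul, smul_sub]
    abel
  have e4 : l * ‖h‖ ^ 2 ≤ ‖(BOp B τ * BOp B τ - BOp B τ₀ * BOp B τ₀) b‖ * ‖h‖ := by
    have e5 := congrArg (fun z => inner ℝ z h) e1
    simp only [inner_add_left, inner_absOp_self, inner_smul_left, real_inner_self_eq_norm_sq,
      RCLike.conj_to_real] at e5
    have e6 := real_inner_le_norm (-((BOp B τ * BOp B τ - BOp B τ₀ * BOp B τ₀) b)) h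
    rw [norm_neg] at e6
    have := quad_nonneg F h τ
    linarith
  rw [le_div_iff₀ hq]
  rcases (norm_nonneg h).eq_or_lt with h0 | h0
  · rw [← h0]; simp
  · rw [mul_comm]
    refine le_of_mul_le_mul_right ?_ h0
    nlinarith

theorem continuousAt_absOp {τ₀ : Centre r} (h : ∀ j, 0 < specVal F τ₀ j) :
    ContinuousAt (absOp F) τ₀ := by
  set b := (F (dir τ₀)).basis
  have h1 : ∀ q, Tendsto (fun τ => absOp F τ (b q)) (𝓝 τ₀) (𝓝 (absOp F τ₀ (b q))) := by
    intro q
    rw [tendsto_iff_norm_sub_tendsto_zero]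
    have h2 : Tendsto (fun τ => ‖(BOp B τ * BOp B τ - BOp B τ₀ * BOp B τ₀) (b q)‖ /
        specVal F τ₀ q.2) (𝓝 τ₀) (𝓝 0) := by
      have h3 : Continuous fun τ => ‖(BOp B τ * BOp B τ - BOp B τ₀ * BOp B τ₀) (b q)‖ /
        specVal F τ₀ q.2 := by fun_prop
      simpa using h3.tendsto τ₀
    refine squeeze_zero (fun _ => norm_nonneg _) (fun τ => ?_) h2
    simpa using norm_absOp_sub_basis_le F τ₀ τ q (h q.2)
  have h4 : ∀ τ, absOp F τ = ∑ q, ContinuousLinearMap.smulRightL ℝ (Horiz n) (Horiz n)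
      (innerSL ℝ (b q)) (absOp F τ (b q)) := by
    intro τ
    refine ContinuousLinearMap.coe_injective (b.toBasis.ext fun q => ?_)
    have h5 := orthonormal_iff_ite.1 b.orthonormal
    simp [h5]
  unfold ContinuousAt
  rw [h4 τ₀]
  refine Tendsto.congr (fun τ => (h4 τ).symm) ?_
  refine tendsto_finsetSum _ fun q _ => ?_
  exact ((ContinuousLinearMap.smulRightL ℝ (Horiz n) (Horiz n)
      (innerSL ℝ (b q))).continuous.tendsto _).comp (h1 q)

/-- The derivative of `X ↦ X²` at `S`. -/
def sqDeriv (S : Horiz n →L[ℝ] Horiz n) :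
    (Horiz n →L[ℝ] Horiz n) →L[ℝ] (Horiz n →L[ℝ] Horiz n) :=
  ContinuousLinearMap.compL ℝ _ _ _ S + (ContinuousLinearMap.compL ℝ _ _ _).flip S

theorem hasFDerivAt_mul_self (S : Horiz n →L[ℝ] Horiz n) :
    HasFDerivAt (fun X : Horiz n →L[ℝ] Horiz n => X * X) (sqDeriv S) S := by
  have := (ContinuousLinearMap.compL ℝ (Horiz n) (Horiz n) (Horiz n)).hasFDerivAt_of_bilinear
    (hasFDerivAt_id S) (hasFDerivAt_id S)
  refine this.congr_fderiv ?_
  ext H v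
  simp [sqDeriv]

/-- If SH + HS = 0 and b is an eigenvector of S with eigenvalue l > 0, then S(Hb) = -l Hb, which S ≥
0 permits only for Hb = 0. -/
theorem sqDeriv_absOp_injective {τ : Centre r} (h : ∀ j, 0 < specVal F τ j) :
    Function.Injective (sqDeriv (absOp F τ)) := by
  rw [injective_iff_map_eq_zero]
  intro H hH
  refine ContinuousLinearMap.coe_injective ((F (dir τ)).basis.toBasis.ext fun q => ?_)
  set b := (F (dir τ)).basis q with hb
  have e1 : absOp F τ (H b) + specVal F τ q.2 • H b = 0 := by
    have := congrArg (fun Z => Z b) hH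
    simpa [sqDeriv, absOp_basis, hb] using this
  have e2 := congrArg (fun z => inner ℝ z (H b)) e1
  simp only [inner_add_left, inner_absOp_self, inner_smul_left, real_inner_self_eq_norm_sq,
      RCLike.conj_to_real, inner_zero_left] at e2
  have e3 := quad_nonneg F (H b) τ
  have e4 : ‖H b‖ ^ 2 = 0 := by
    have := h q.2
    have h5 : specVal F τ q.2 * ‖H b‖ ^ 2 ≤ 0 := by linarith
    nlinarith [sq_nonneg ‖H b‖]
  simpa using e4

/-- The map X ↦ X² is locally invertible at |B^{τ₀}|. Continuity of |B^τ| keeps it in the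
neighbourhood where the local inverse recovers X from X², so near τ₀ it is the smooth local inverse
applied to -(B^τ)². -/
theorem contDiffAt_absOp {τ₀ : Centre r} (h : ∀ j, 0 < specVal F τ₀ j) {k : ℕ} (hk : k ≠ 0) :
    ContDiffAt ℝ k (absOp F) τ₀ := by
  let e := (LinearEquiv.ofInjectiveEndo (sqDeriv (absOp F τ₀)).toLinearMap
    (sqDeriv_absOp_injective F h)).toContinuousLinearEquiv
  have he : (e : (Horiz n →L[ℝ] Horiz n) →L[ℝ] (Horiz n →L[ℝ] Horiz n)) =
      sqDeriv (absOp F τ₀) := by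
    ext1 H; rfl
  have hk' : (k : WithTop ℕ∞) ≠ 0 := by exact_mod_cast hk
  have h1 : ContDiffAt ℝ k (fun X : Horiz n →L[ℝ] Horiz n => X * X) (absOp F τ₀) :=
    contDiffAt_id.mul contDiffAt_id
  have h2 : HasFDerivAt (fun X : Horiz n →L[ℝ] Horiz n => X * X)
      (e : (Horiz n →L[ℝ] Horiz n) →L[ℝ] (Horiz n →L[ℝ] Horiz n)) (absOp F τ₀) := by
    rw [he]; exact hasFDerivAt_mul_self _
  have h3 := h1.to_localInverse h2 hk'
  have h4 := (continuousAt_absOp F h).eventually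
    (h1.hasStrictFDerivAt' h2 hk').eventually_left_inverse
  have h5 : ContDiffAt ℝ k (fun τ => -(BOp B τ * BOp B τ)) τ₀ := by fun_prop
  have h6 : ContDiffAt ℝ k (fun τ => h1.localInverse h2 hk' (-(BOp B τ * BOp B τ))) τ₀ := by
    refine ContDiffAt.comp τ₀ ?_ h5
    rw [← absOp_mul_self F]
    exact h3
  refine h6.congr_of_eventuallyEq ?_
  filter_upwards [h4] with τ hτ
  rw [← absOp_mul_self F]
  exact hτ.symm

theorem contDiff_det_BTau (k : ℕ) : ContDiff ℝ k fun τ : Centre r => (BTau B τ).det := by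
  simp only [Matrix.det_apply, BTau, Matrix.sum_apply, Matrix.smul_apply]
  fun_prop

theorem IsNondegenerate.specVal_pos (hB : IsNondegenerate B) {τ : Centre r} (hτ : τ ≠ 0)
    (j : Fin n) : 0 < specVal F τ j := by
  obtain ⟨c, hc, h⟩ := hB.exists_le_specVal
  have : 0 < ‖τ‖ := norm_pos_iff.2 hτ
  exact lt_of_lt_of_le (by positivity) (h F τ j)

theorem IsNondegenerate.contDiffAt_prod_specVal (hB : IsNondegenerate B) {τ : Centre r}
    (hτ : τ ≠ 0) (k : ℕ) : ContDiffAt ℝ k (fun τ => ∏ j, specVal F τ j) τ := by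
  simp only [prod_specVal_eq F]
  exact (contDiff_det_BTau k).contDiffAt.sqrt (hB.det_ne_zero τ hτ)

theorem IsNondegenerate.contDiffAt_absOp (hB : IsNondegenerate B) {τ : Centre r}
    (hτ : τ ≠ 0) (k : ℕ) : ContDiffAt ℝ k (absOp F) τ :=
  (StepTwo.contDiffAt_absOp F (hB.specVal_pos F hτ) k.succ_ne_zero).of_le
    (by exact_mod_cast k.le_succ)

end

end StepTwo

/-! ### Size, homogeneity and measurability of Q_m -/

namespace StepTwo

noncomputable section

/-- Half of the exponential absorbs the polynomial, since (u/2)^i / i! ≤ e^{u/2}. -/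
theorem exists_abs_eval_mul_exp_neg_le (p : Polynomial ℝ) :
    ∃ C : ℝ, 0 ≤ C ∧ ∀ u : ℝ, 0 ≤ u → |p.eval u * Real.exp (-u)| ≤ C * Real.exp (-(u / 2)) := by
  refine ⟨∑ i ∈ Finset.range (p.natDegree + 1), |p.coeff i| * (2 ^ i * i.factorial),
    by positivity, fun u hu => ?_⟩
  have h1 : |p.eval u| ≤ (∑ i ∈ Finset.range (p.natDegree + 1),
      |p.coeff i| * (2 ^ i * i.factorial)) * Real.exp (u / 2) := by
    rw [Polynomial.eval_eq_sum_range, Finset.sum_mul]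
    refine (Finset.abs_sum_le_sum_abs _ _).trans (Finset.sum_le_sum fun i _ => ?_)
    have h2 := Real.pow_div_factorial_le_exp (u / 2) (by positivity) i
    rw [div_le_iff₀ (by positivity), div_pow, div_le_iff₀ (by positivity)] at h2
    rw [abs_mul, abs_of_nonneg (pow_nonneg hu i), mul_assoc]
    gcongr
    linarith
  rw [abs_mul, Real.abs_exp]
  calc _ ≤ _ := mul_le_mul_of_nonneg_right h1 (Real.exp_pos _).le
    _ = _ := by rw [mul_assoc, ← Real.exp_add]; ring_nf

theorem pow_mul_exp_neg_le {a : ℝ} (ha : 0 < a) (N : ℕ) {s : ℝ} (hs : 0 ≤ s) :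
    (1 + s) ^ N * Real.exp (-(a * s)) ≤ N.factorial * Real.exp a / a ^ N := by
  have h2 := Real.pow_div_factorial_le_exp (a * (1 + s)) (by positivity) N
  rw [div_le_iff₀ (by positivity), mul_pow] at h2
  rw [le_div_iff₀ (by positivity)]
  calc (1 + s) ^ N * Real.exp (-(a * s)) * a ^ N
      = (a ^ N * (1 + s) ^ N) * Real.exp (-(a * s)) := by ring
    _ ≤ (Real.exp (a * (1 + s)) * N.factorial) * Real.exp (-(a * s)) := by gcongr
    _ = N.factorial * (Real.exp (a * (1 + s)) * Real.exp (-(a * s))) := by ring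
    _ = _ := by rw [← Real.exp_add]; ring_nf

theorem integrable_inv_one_add_norm_pow {E : Type*} [NormedAddCommGroup E] [NormedSpace ℝ E]
    [FiniteDimensional ℝ E] [MeasurableSpace E] [BorelSpace E] (μ : Measure E)
    [μ.IsAddHaarMeasure] {k : ℕ} (hk : Module.finrank ℝ E < k) :
    Integrable (fun x : E => ((1 + ‖x‖) ^ k)⁻¹) μ := by
  have := integrable_one_add_norm (μ := μ) (E := E) (r := k) (by exact_mod_cast hk)
  refine this.congr (.of_forall fun x => ?_)
  simp only
  rw [Real.rpow_neg (by positivity), Real.rpow_natCast]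

variable {n r : ℕ} {B : Fin r → Matrix (Fin (2 * n)) (Fin (2 * n)) ℝ}
variable (F : ∀ ω : Centre r, NormalFrame (BTau B ω)) (m : ℕ)

theorem specVal_smul {c : ℝ} (hc : 0 < c) (τ : Centre r) (j : Fin n) :
    specVal F (c • τ) j = c * specVal F τ j := by
  rw [specVal, specVal, dir_smul hc, norm_smul, Real.norm_of_nonneg hc.le, mul_assoc]

theorem tauCoord_smul_right {c : ℝ} (hc : 0 < c) (y : Horiz n) (τ : Centre r) (j : Fin n) :
    tauCoord F y (c • τ) j = tauCoord F y τ j := by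
  rw [tauCoord, tauCoord, dir_smul hc]

theorem tauCoord_smul_left (c : ℝ) (y : Horiz n) (τ : Centre r) (j : Fin n) :
    tauCoord F (c • y) τ j = c • tauCoord F y τ j := by
  ext i
  fin_cases i <;> simp [tauCoord]

theorem quad_smul_right {c : ℝ} (hc : 0 < c) (y : Horiz n) (τ : Centre r) :
    quad F y (c • τ) = c * quad F y τ := by
  simp only [quad, specVal_smul F hc, tauCoord_smul_right F hc, Finset.mul_sum, mul_assoc]

theorem quad_smul_left (c : ℝ) (y : Horiz n) (τ : Centre r) :
    quad F (c • y) τ = c ^ 2 * quad F y τ := by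
  simp only [quad, tauCoord_smul_left, Finset.mul_sum, norm_smul, mul_pow, Real.norm_eq_abs, sq_abs]
  exact Finset.sum_congr rfl fun j _ => by ring

/-- The quadratic form sees τ and y only through a quantity of degree one in τ and two in y, while
the n singular values in front contribute c² each. -/
theorem Qm_dil {c : ℝ} (hc : 0 < c) (y : Horiz n) (τ : Centre r) :
    Qm F m y (c ^ 2 • τ) = c ^ (2 * n) * Qm F m (c • y) τ := by
  obtain ⟨p, hp⟩ := exists_Qm_eq n m
  rw [hp, hp, quad_smul_right F (by positivity), quad_smul_left]
  simp only [specVal_smul F (c := c ^ 2) (by positivity), Finset.prod_mul_distrib,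
    Finset.prod_const, Finset.card_univ, Fintype.card_fin]
  ring

theorem Qm_zero (hn : 0 < n) (y : Horiz n) : Qm F m y 0 = 0 := by
  obtain ⟨p, hp⟩ := exists_Qm_eq n m
  rw [hp, Finset.prod_eq_zero (i := (⟨0, hn⟩ : Fin n)) (Finset.mem_univ _) (by simp [specVal]),
    zero_mul]

/-- The power |τ|^n bounds the product of singular values; the Gaussian factor is the lower bound
for the quadratic form. -/
theorem IsNondegenerate.exists_abs_Qm_le (hB : IsNondegenerate B) :
    ∃ C c : ℝ, 0 ≤ C ∧ 0 < c ∧ ∀ (y : Horiz n) (τ : Centre r),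
      |Qm F m y τ| ≤ C * ‖τ‖ ^ n * Real.exp (-(c * ‖τ‖ * ‖y‖ ^ 2)) := by
  obtain ⟨p, hp⟩ := exists_Qm_eq n m
  obtain ⟨C, hC, hpC⟩ := exists_abs_eval_mul_exp_neg_le p
  obtain ⟨c, hc, hcs⟩ := hB.exists_le_specVal
  refine ⟨‖BOp B‖ ^ n * C, c / 2, by positivity, by positivity, fun y τ => ?_⟩
  have h1 : |∏ j, specVal F τ j| ≤ (‖BOp B‖ * ‖τ‖) ^ n := by
    rw [Finset.abs_prod]
    calc ∏ j, |specVal F τ j| ≤ ∏ _j : Fin n, (‖BOp B‖ * ‖τ‖) :=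
          Finset.prod_le_prod (fun j _ => abs_nonneg _) fun j _ => by
            rw [abs_of_nonneg (specVal_nonneg F τ j)]; exact specVal_le F τ j
      _ = _ := by simp
  rw [hp, abs_mul]
  have h2 := hpC _ (quad_nonneg F y τ)
  have h3 := le_quad F (hcs F) y τ
  calc _ ≤ (‖BOp B‖ * ‖τ‖) ^ n * (C * Real.exp (-(quad F y τ / 2))) := by gcongr
    _ ≤ (‖BOp B‖ * ‖τ‖) ^ n * (C * Real.exp (-(c / 2 * ‖τ‖ * ‖y‖ ^ 2))) := by
        gcongr; linarith
    _ = _ := by ring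

theorem IsNondegenerate.continuousAt_Qm (hB : IsNondegenerate B) {x : Space n r} (hx : x.2 ≠ 0) :
    ContinuousAt (fun p : Space n r => Qm F m p.1 p.2) x := by
  obtain ⟨p, hp⟩ := exists_Qm_eq n m
  simp only [hp, ← inner_absOp_self]
  have h1 : ContinuousAt (fun p : Space n r => absOp F p.2) x :=
    (hB.contDiffAt_absOp F hx 0).continuousAt.comp continuousAt_snd
  have h2 : ContinuousAt (fun p : Space n r => ∏ j, specVal F p.2 j) x :=
    (hB.contDiffAt_prod_specVal F hx 0).continuousAt.comp
      (f := fun p : Space n r => p.2) continuousAt_snd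
  have h3 : ContinuousAt (fun p : Space n r => inner ℝ (absOp F p.2 p.1) p.1) x :=
    (h1.clm_apply continuousAt_fst).inner continuousAt_fst
  exact h2.mul ((p.continuous.continuousAt.comp h3).mul
    (Real.continuous_exp.continuousAt.comp h3.neg))

/-- The frames need not depend measurably on τ. Measurability comes instead from continuity off τ =
0 and vanishing at τ = 0, where n > 0 is used. -/
theorem IsNondegenerate.measurable_Qm (hB : IsNondegenerate B) :
    Measurable (fun p : Space n r => Qm F m p.1 p.2) := by
  classical
  set s : Set (Space n r) := {p | p.2 ≠ 0}
  have hs : IsOpen s := isOpen_ne_fun continuous_snd continuous_const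
  have h1 : ContinuousOn (fun p : Space n r => Qm F m p.1 p.2) s := fun x hx =>
    (hB.continuousAt_Qm F m hx).continuousWithinAt
  have h2 := h1.measurable_piecewise (g := fun _ => (0 : ℝ)) continuousOn_const hs.measurableSet
  convert h2 using 1
  funext p
  by_cases hp : p ∈ s
  · simp [hp]
  · have : p.2 = 0 := by simpa [s] using hp
    simp [hp, this, Qm_zero F m hB.horiz_pos]

theorem IsNondegenerate.measurable_Qm_right (hB : IsNondegenerate B) (y : Horiz n) :
    Measurable (fun τ : Centre r => Qm F m y τ) :=
  Measurable.comp (g := fun p : Space n r => Qm F m p.1 p.2) (f := fun τ => (y, τ))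
    (hB.measurable_Qm F m) measurable_prodMk_left

theorem IsNondegenerate.integrable_Qm (hB : IsNondegenerate B) {y : Horiz n} (hy : y ≠ 0) :
    Integrable (fun τ : Centre r => Qm F m y τ) := by
  obtain ⟨C, c, hC, hc, h⟩ := hB.exists_abs_Qm_le F m
  have ha : 0 < c * ‖y‖ ^ 2 := by have := norm_pos_iff.2 hy; positivity
  set a := c * ‖y‖ ^ 2
  set M := (n + (r + 1)).factorial * Real.exp a / a ^ (n + (r + 1))
  have h1 : Integrable (fun τ : Centre r => C * M * ((1 + ‖τ‖) ^ (r + 1))⁻¹) :=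
    (integrable_inv_one_add_norm_pow volume (by simp)).const_mul _
  refine h1.mono' (hB.measurable_Qm_right F m y).aestronglyMeasurable (.of_forall fun τ => ?_)
  refine (h y τ).trans ?_
  have h2 := pow_mul_exp_neg_le ha (n + (r + 1)) (norm_nonneg τ)
  rw [mul_assoc C, mul_assoc C]
  refine mul_le_mul_of_nonneg_left ?_ hC
  rw [← div_eq_mul_inv, le_div_iff₀ (by positivity)]
  refine le_trans ?_ h2
  rw [show c * ‖τ‖ * ‖y‖ ^ 2 = a * ‖τ‖ by simp only [a]; ring]
  have : ‖τ‖ ^ n ≤ (1 + ‖τ‖) ^ n := by gcongr; linarith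
  calc _ = ‖τ‖ ^ n * (1 + ‖τ‖) ^ (r + 1) * Real.exp (-(a * ‖τ‖)) := by ring
    _ ≤ (1 + ‖τ‖) ^ (n + (r + 1)) * Real.exp (-(a * ‖τ‖)) := by rw [pow_add _ n]; gcongr

/-- The kernel `P_m` with an additional weight `w(τ)` under the Fourier integral. -/
def weightedPm (w : Centre r → ℝ) (x : Space n r) : ℂ :=
  1 / (2 * Real.pi : ℂ) ^ r *
    ∫ τ : Centre r, Complex.exp (Complex.I * (inner ℝ x.2 τ : ℝ)) * ((w τ * Qm F m x.1 τ : ℝ) : ℂ)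

theorem weightedPm_one : weightedPm F m (fun _ => 1) = PmAux F m := by
  funext x
  simp [weightedPm, PmAux]

theorem IsNondegenerate.stronglyMeasurable_weightedPm (hB : IsNondegenerate B) {w : Centre r → ℝ}
    (hw : Measurable w) : StronglyMeasurable (weightedPm F m w) := by
  unfold weightedPm
  refine StronglyMeasurable.const_mul ?_ _
  refine StronglyMeasurable.integral_prod_right'
    (f := fun q : Space n r × Centre r => Complex.exp (Complex.I * (inner ℝ q.1.2 q.2 : ℝ)) *
      ((w q.2 * Qm F m q.1.1 q.2 : ℝ) : ℂ)) ?_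
  refine Measurable.stronglyMeasurable ?_
  refine Measurable.mul ?_ ?_
  · exact Continuous.measurable (by fun_prop)
  · refine Complex.measurable_ofReal.comp ((hw.comp measurable_snd).mul ?_)
    exact Measurable.comp (g := fun p : Space n r => Qm F m p.1 p.2)
      (f := fun q : Space n r × Centre r => ((q.1.1, q.2) : Space n r))
      (hB.measurable_Qm F m) (measurable_fst.fst.prodMk measurable_snd)

/-- Substitute c⁻²τ for τ: the Jacobian gives c^{-2r} and the homogeneity of Q_m gives c^{-2n}. The
weight is carried along so that one computation serves both P_m (w = 1) and its dyadic pieces. -/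
theorem weightedPm_dil {c : ℝ} (hc : 0 < c) (w : Centre r → ℝ) (x : Space n r) :
    weightedPm F m w (dil c x) = ((c ^ (2 * n + 2 * r))⁻¹ : ℝ) *
      weightedPm F m (fun τ => w ((c ^ 2)⁻¹ • τ)) x := by
  simp only [weightedPm, dil]
  have h1 := Measure.integral_comp_smul (volume : Measure (Centre r)) (fun τ =>
    Complex.exp (Complex.I * (inner ℝ (c ^ 2 • x.2) ((c ^ 2)⁻¹ • τ) : ℝ)) *
      ((w ((c ^ 2)⁻¹ • τ) * Qm F m (c • x.1) ((c ^ 2)⁻¹ • τ) : ℝ) : ℂ)) (c ^ 2)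
  have hc2 : c ^ 2 ≠ 0 := by positivity
  simp only [smul_smul, inv_mul_cancel₀ hc2, one_smul] at h1
  rw [h1]
  have h2 : ∀ τ : Centre r, Complex.exp (Complex.I * (inner ℝ (c ^ 2 • x.2) ((c ^ 2)⁻¹ • τ) : ℝ)) *
      ((w ((c ^ 2)⁻¹ • τ) * Qm F m (c • x.1) ((c ^ 2)⁻¹ • τ) : ℝ) : ℂ) = ((c ^ (2 * n))⁻¹ : ℝ) *
      (Complex.exp (Complex.I * (inner ℝ x.2 τ : ℝ)) *
        ((w ((c ^ 2)⁻¹ • τ) * Qm F m x.1 τ : ℝ) : ℂ)) := by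
    intro τ
    have h3 := Qm_dil F m hc x.1 ((c ^ 2)⁻¹ • τ)
    rw [smul_smul, mul_inv_cancel₀ hc2, one_smul] at h3
    rw [inner_smul_left, inner_smul_right, h3]
    have h4 : (starRingEnd ℝ) (c ^ 2) * ((c ^ 2)⁻¹ * inner ℝ x.2 τ) = inner ℝ x.2 τ := by
      rw [RCLike.conj_to_real]; field_simp
    rw [h4]
    push_cast
    have : (c : ℂ) ≠ 0 := by exact_mod_cast hc.ne'
    field_simp
  simp only [h2, integral_const_mul]
  rw [finrank_euclideanSpace, Fintype.card_fin, abs_of_nonneg (by positivity), Complex.real_smul]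
  push_cast
  rw [pow_add, mul_inv, ← pow_mul]
  ring

theorem IsNondegenerate.stronglyMeasurable_PmAux (hB : IsNondegenerate B) :
    StronglyMeasurable (PmAux F m) := by
  rw [← weightedPm_one]
  exact hB.stronglyMeasurable_weightedPm F m measurable_const

theorem PmAux_dil {c : ℝ} (hc : 0 < c) (x : Space n r) :
    PmAux F m (dil c x) = ((c ^ (2 * n + 2 * r))⁻¹ : ℝ) * PmAux F m x := by
  simp only [← weightedPm_one]
  exact weightedPm_dil F m hc _ x

theorem Pm_eq_PmAux {x : Space n r} (hx : x.1 ≠ 0) : Pm F m x = PmAux F m x := by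
  simp [Pm, hx]

end

end StepTwo

/-! ### Decay of Fourier integrals and derivative bounds in τ -/

namespace StepTwo

noncomputable section

/-- The Fourier integral `∫ e^{i t·τ} f(τ) dτ`. -/
def osc {r : ℕ} (f : Centre r → ℂ) (t : Centre r) : ℂ :=
  ∫ τ : Centre r, Complex.exp (Complex.I * (inner ℝ t τ : ℝ)) * f τ

theorem norm_exp_I_mul (x : ℝ) : ‖Complex.exp (Complex.I * (x : ℂ))‖ = 1 := by
  rw [mul_comm, Complex.norm_exp_ofReal_mul_I]

theorem osc_eq_fourier {r : ℕ} (f : Centre r → ℂ) (t : Centre r) :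
    osc f t = FourierTransform.fourier f (-(2 * Real.pi)⁻¹ • t) := by
  rw [osc, Real.fourier_eq']
  refine integral_congr_ae (.of_forall fun τ => ?_)
  simp only [smul_eq_mul, inner_smul_right, real_inner_comm t τ]
  congr 2
  push_cast
  have : (Real.pi : ℂ) ≠ 0 := by exact_mod_cast Real.pi_ne_zero
  field_simp

/-- Integration by parts N times. The constant is chosen before f, which is what later makes the
estimates uniform in y and linear in Schwartz seminorms. -/
theorem pow_mul_norm_osc_le {r : ℕ} (N : ℕ) : ∃ C : ℝ, 0 ≤ C ∧ ∀ (f : Centre r → ℂ),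
    ContDiff ℝ N f → (∀ p ≤ N, Integrable fun τ => ‖iteratedFDeriv ℝ p f τ‖) → ∀ t,
    (1 + ‖t‖) ^ N * ‖osc f t‖ ≤
      C * ∑ p ∈ Finset.range (N + 1), ∫ τ, ‖iteratedFDeriv ℝ p f τ‖ := by
  refine ⟨2 ^ N * (1 + (2 * Real.pi) ^ N * 2 ^ N), by positivity, fun f hf hi t => ?_⟩
  set S := ∑ p ∈ Finset.range (N + 1), ∫ τ, ‖iteratedFDeriv ℝ p f τ‖ with hS
  have h0 : ‖osc f t‖ ≤ S := by
    have h1 : ‖osc f t‖ ≤ ∫ τ, ‖iteratedFDeriv ℝ 0 f τ‖ := by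
      refine (norm_integral_le_integral_norm _).trans (le_of_eq ?_)
      refine integral_congr_ae (.of_forall fun τ => ?_)
      simp only [norm_mul, norm_exp_I_mul, one_mul, norm_iteratedFDeriv_zero]
    refine h1.trans ?_
    exact Finset.single_le_sum (f := fun p => ∫ τ, ‖iteratedFDeriv ℝ p f τ‖)
      (fun p _ => integral_nonneg fun _ => norm_nonneg _) (by simp)
  have hN : ‖t‖ ^ N * ‖osc f t‖ ≤ (2 * Real.pi) ^ N * 2 ^ N * S := by
    have h2 := Real.pow_mul_norm_iteratedFDeriv_fourier_le (K := 0) (N := N) (k := 0) (n := N)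
      (f := f) (by exact_mod_cast hf) (fun k p hk hp => by
        have hk0 : k = 0 := by simpa using hk
        simpa [hk0] using hi p (by exact_mod_cast hp)) le_rfl le_rfl (-(2 * Real.pi)⁻¹ • t)
    simp only [pow_zero, norm_iteratedFDeriv_zero, CharP.cast_eq_zero, mul_zero, zero_add, one_mul,
      Finset.range_one, Finset.singleton_product, Finset.sum_map,
      Function.Embedding.coeFn_mk] at h2
    have h3 : ‖t‖ = (2 * Real.pi) * ‖-(2 * Real.pi)⁻¹ • t‖ := by
      rw [norm_smul, norm_neg, norm_inv, Real.norm_of_nonneg (by positivity), ← mul_assoc,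
        mul_inv_cancel₀ (by positivity), one_mul]
    rw [osc_eq_fourier, h3, mul_pow, mul_assoc, mul_assoc]
    exact mul_le_mul_of_nonneg_left h2 (by positivity)
  have h4 : (1 + ‖t‖) ^ N ≤ 2 ^ N * (1 + ‖t‖ ^ N) := by
    rcases le_total ‖t‖ 1 with h | h
    · calc (1 + ‖t‖) ^ N ≤ 2 ^ N := by gcongr; linarith
        _ ≤ _ := by
          have : 0 ≤ ‖t‖ ^ N := by positivity
          nlinarith [show (0 : ℝ) < 2 ^ N by positivity]
    · calc (1 + ‖t‖) ^ N ≤ (2 * ‖t‖) ^ N := by gcongr; linarith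
        _ = 2 ^ N * ‖t‖ ^ N := mul_pow _ _ _
        _ ≤ _ := by gcongr; linarith
  calc (1 + ‖t‖) ^ N * ‖osc f t‖ ≤ 2 ^ N * (1 + ‖t‖ ^ N) * ‖osc f t‖ := by gcongr
    _ = 2 ^ N * (‖osc f t‖ + ‖t‖ ^ N * ‖osc f t‖) := by ring
    _ ≤ 2 ^ N * (S + (2 * Real.pi) ^ N * 2 ^ N * S) := by gcongr
    _ = _ := by ring

theorem iteratedDeriv_eval_mul_exp_neg (p : Polynomial ℝ) (i : ℕ) : ∃ q : Polynomial ℝ,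
    iteratedDeriv i (fun u => p.eval u * Real.exp (-u)) = fun u => q.eval u * Real.exp (-u) := by
  induction i with
  | zero => exact ⟨p, by simp⟩
  | succ i ih =>
    obtain ⟨q, hq⟩ := ih
    refine ⟨q.derivative - q, ?_⟩
    rw [iteratedDeriv_succ, hq]
    funext u
    have h := (q.hasDerivAt u).mul ((hasDerivAt_neg u).exp)
    refine (h.deriv).trans ?_
    rw [Polynomial.eval_sub]
    ring

theorem exists_norm_iteratedFDeriv_eval_mul_exp_neg_le (p : Polynomial ℝ) (N : ℕ) :
    ∃ C : ℝ, 0 ≤ C ∧ ∀ i ≤ N, ∀ u : ℝ, 0 ≤ u →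
      ‖iteratedFDeriv ℝ i (fun u => p.eval u * Real.exp (-u)) u‖ ≤ C * Real.exp (-(u / 2)) := by
  choose q hq using iteratedDeriv_eval_mul_exp_neg p
  choose C hC h using exists_abs_eval_mul_exp_neg_le
  refine ⟨∑ i ∈ Finset.range (N + 1), C (q i), Finset.sum_nonneg fun i _ => hC _,
    fun i hi u hu => ?_⟩
  rw [norm_iteratedFDeriv_eq_norm_iteratedDeriv, hq]
  refine (h (q i) u hu).trans ?_
  gcongr
  exact Finset.single_le_sum (f := fun i => C (q i)) (fun i _ => hC _) (by simp; omega)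

theorem exists_iteratedFDerivWithin_le {V W : Type*} [NormedAddCommGroup V] [NormedSpace ℝ V]
    [NormedAddCommGroup W] [NormedSpace ℝ W] {U A : Set V} (hU : IsOpen U) (hA : IsCompact A)
    (hAU : A ⊆ U) {N : ℕ} {a : V → W} (ha : ContDiffOn ℝ N a U) :
    ∃ C : ℝ, 0 ≤ C ∧ ∀ i ≤ N, ∀ τ ∈ A, ‖iteratedFDerivWithin ℝ i a U τ‖ ≤ C := by
  have h : ∀ i : ℕ, ∃ C : ℝ, 0 ≤ C ∧ (i ≤ N → ∀ τ ∈ A, ‖iteratedFDerivWithin ℝ i a U τ‖ ≤ C) := by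
    intro i
    by_cases hi : i ≤ N
    · have h1 := ha.continuousOn_iteratedFDerivWithin (m := i) (by exact_mod_cast hi)
        hU.uniqueDiffOn
      obtain ⟨C, hC⟩ := hA.exists_bound_of_continuousOn (h1.mono hAU)
      exact ⟨max C 0, le_max_right _ _, fun _ τ hτ => (hC τ hτ).trans (le_max_left _ _)⟩
    · exact ⟨0, le_rfl, fun h => absurd h hi⟩
  choose C hC0 hC using h
  refine ⟨∑ i ∈ Finset.range (N + 1), C i, Finset.sum_nonneg fun i _ => hC0 i,
    fun i hi τ hτ => (hC i hi τ hτ).trans ?_⟩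
  exact Finset.single_le_sum (f := C) (fun i _ => hC0 _) (by simp; omega)

/-- Each derivative in τ that falls on ⟨S(τ)y, y⟩ costs a factor of order 1 + |y|², and coercivity
on A keeps a Gaussian in y that pays for it. As a vanishes off the compact set A ⊆ U, the product
extends smoothly by zero, so nothing is required of S outside U. -/
theorem exists_iteratedFDeriv_mul_comp_le {V E : Type*} [NormedAddCommGroup V] [NormedSpace ℝ V]
    [NormedAddCommGroup E] [InnerProductSpace ℝ E] {U A : Set V} (hU : IsOpen U) (hA : IsCompact A)
    (hAU : A ⊆ U) (N : ℕ) {a : V → ℝ} (ha : ContDiffOn ℝ N a U) (ha0 : ∀ τ ∉ A, a τ = 0)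
    {S : V → E →L[ℝ] E} (hS : ContDiffOn ℝ N S U) (p : Polynomial ℝ) {c : ℝ} (hc : 0 < c)
    (hcS : ∀ τ ∈ A, ∀ y, c * ‖y‖ ^ 2 ≤ inner ℝ (S τ y) y) :
    ∃ C : ℝ, 0 ≤ C ∧ ∀ y : E,
      ContDiff ℝ N (fun τ => a τ * (p.eval (inner ℝ (S τ y) y) *
        Real.exp (-(inner ℝ (S τ y) y)))) ∧
      ∀ i ≤ N, ∀ τ, ‖iteratedFDeriv ℝ i (fun τ => a τ * (p.eval (inner ℝ (S τ y) y) *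
        Real.exp (-(inner ℝ (S τ y) y)))) τ‖ ≤
          A.indicator (fun _ => C * (1 + ‖y‖ ^ 2) ^ N * Real.exp (-(c / 2 * ‖y‖ ^ 2))) τ := by
  obtain ⟨Ca, hCa0, hCa⟩ := exists_iteratedFDerivWithin_le hU hA hAU ha
  obtain ⟨CS, hCS0, hCS⟩ := exists_iteratedFDerivWithin_le hU hA hAU hS
  obtain ⟨Cg, hCg0, hCg⟩ := exists_norm_iteratedFDeriv_eval_mul_exp_neg_le p N
  set g : ℝ → ℝ := fun u => p.eval u * Real.exp (-u) with hg
  have hgN : ContDiff ℝ N g := by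
    have : ContDiff ℝ N fun u => p.eval u := by simpa using p.contDiff_aeval (𝕜 := ℝ) N
    exact this.mul (Real.contDiff_exp.comp contDiff_neg)
  refine ⟨∑ i ∈ Finset.range (N + 1), ∑ l ∈ Finset.range (i + 1),
    (i.choose l : ℝ) * Ca * ((i - l).factorial * Cg * (1 + CS) ^ (i - l)), by positivity,
    fun y => ?_⟩
  let L : (E →L[ℝ] E) →L[ℝ] ℝ := (innerSL ℝ y).comp (ContinuousLinearMap.apply ℝ E y)
  have hL : ‖L‖ ≤ ‖y‖ ^ 2 := by
    refine L.opNorm_le_bound (by positivity) fun X => ?_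
    calc ‖L X‖ = |inner ℝ y (X y)| := rfl
      _ ≤ ‖y‖ * ‖X y‖ := abs_real_inner_le_norm _ _
      _ ≤ ‖y‖ * (‖X‖ * ‖y‖) := by gcongr; exact X.le_opNorm y
      _ = _ := by ring
  have hLS : ∀ τ, inner ℝ (S τ y) y = L (S τ) := fun τ => real_inner_comm _ _
  set f : V → ℝ := fun τ => L (S τ) with hf
  have hfN : ContDiffOn ℝ N f U := L.contDiff.comp_contDiffOn hS
  simp only [hLS]
  change ContDiff ℝ N (fun τ => a τ * (g ∘ f) τ) ∧ ∀ i ≤ N, ∀ τ,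
    ‖iteratedFDeriv ℝ i (fun τ => a τ * (g ∘ f) τ) τ‖ ≤ _
  have hgf : ContDiffOn ℝ N (g ∘ f) U := hgN.comp_contDiffOn hfN
  have hag : ContDiffOn ℝ N (fun τ => a τ * (g ∘ f) τ) U := ha.mul hgf
  have hout : ∀ τ ∉ A, (fun τ => a τ * (g ∘ f) τ) =ᶠ[𝓝 τ] fun _ => 0 := by
    intro τ hτ
    filter_upwards [hA.isClosed.isOpen_compl.mem_nhds hτ] with σ hσ
    rw [ha0 σ hσ, zero_mul]
  refine ⟨contDiff_iff_contDiffAt.2 fun τ => ?_, fun i hi τ => ?_⟩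
  · by_cases hτ : τ ∈ A
    · exact hag.contDiffAt (hU.mem_nhds (hAU hτ))
    · exact contDiffAt_const.congr_of_eventuallyEq (hout τ hτ)
  by_cases hτ : τ ∈ A
  swap
  · rw [(hout τ hτ).iteratedFDeriv ℝ i |>.self_of_nhds]
    simp [Set.indicator_of_notMem hτ]
  rw [Set.indicator_of_mem hτ]
  have hfτ : c * ‖y‖ ^ 2 ≤ f τ := by rw [hf]; simp only [← hLS]; exact hcS τ hτ y
  have hf0 : 0 ≤ f τ := le_trans (by positivity) hfτ
  set X := 1 + ‖y‖ ^ 2 with hX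
  have hX1 : 1 ≤ X := by rw [hX]; nlinarith [sq_nonneg ‖y‖]
  set e := Real.exp (-(c / 2 * ‖y‖ ^ 2)) with he
  have hcomp : ∀ l ≤ N, ‖iteratedFDerivWithin ℝ l (g ∘ f) U τ‖ ≤
      l.factorial * (Cg * e) * ((1 + CS) * X) ^ l := by
    intro l hl
    -- The composition bound asks that the j-th derivative of f be at most D^j for j ≥ 1. Every
    -- derivative is at most |y|² `CS`, so D = (1 + `CS`)(1 + |y|²) will do, because D ≥ 1.
    refine norm_iteratedFDerivWithin_comp_le (t := Set.univ) (N := N) hgN.contDiffOn hfN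
      (by exact_mod_cast hl) uniqueDiffOn_univ hU.uniqueDiffOn (Set.mapsTo_univ _ _) (hAU hτ)
      (fun j hj => ?_) (fun j hj1 hj => ?_)
    · rw [iteratedFDerivWithin_univ]
      refine (hCg j (hj.trans hl) _ hf0).trans ?_
      rw [he]
      gcongr
      linarith
    · have h1 : ‖iteratedFDerivWithin ℝ j f U τ‖ ≤ ‖L‖ * ‖iteratedFDerivWithin ℝ j S U τ‖ :=
        L.norm_iteratedFDerivWithin_comp_left (N := N) (n := j) (hS τ (hAU hτ)) hU.uniqueDiffOn (hAU hτ)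
          (by exact_mod_cast hj.trans hl)
      have h2 := hCS j (hj.trans hl) τ hτ
      calc _ ≤ _ := h1
        _ ≤ ‖y‖ ^ 2 * CS := by gcongr
        _ ≤ (1 + CS) * X := by rw [hX]; nlinarith [sq_nonneg ‖y‖]
        _ ≤ ((1 + CS) * X) ^ j := by
          refine le_self_pow₀ ?_ (by omega)
          nlinarith
  have hmul := norm_iteratedFDerivWithin_mul_le (N := N) ha hgf hU.uniqueDiffOn (hAU hτ) (n := i)
    (by exact_mod_cast hi)
  rw [iteratedFDerivWithin_of_isOpen _ hU (hAU hτ)] at hmul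
  refine hmul.trans ?_
  have hterm : ∀ l ∈ Finset.range (i + 1), (i.choose l : ℝ) * ‖iteratedFDerivWithin ℝ l a U τ‖ *
      ‖iteratedFDerivWithin ℝ (i - l) (g ∘ f) U τ‖ ≤
      ((i.choose l : ℝ) * Ca * ((i - l).factorial * Cg * (1 + CS) ^ (i - l))) * (X ^ N * e) := by
    intro l hl
    have hl' : l ≤ N := by simp at hl; omega
    have h1 := hCa l hl' τ hτ
    have h2 := hcomp (i - l) (by omega)
    calc _ ≤ (i.choose l : ℝ) * Ca * ((i - l).factorial * (Cg * e) * ((1 + CS) * X) ^ (i - l)) := by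
          gcongr
      _ = ((i.choose l : ℝ) * Ca * ((i - l).factorial * Cg * (1 + CS) ^ (i - l))) *
          (X ^ (i - l) * e) := by rw [mul_pow]; ring
      _ ≤ _ := by
          have : i - l ≤ N := by omega
          gcongr
  refine (Finset.sum_le_sum hterm).trans ?_
  rw [← Finset.sum_mul, mul_assoc]
  gcongr
  exact Finset.single_le_sum (f := fun i => ∑ l ∈ Finset.range (i + 1),
    (i.choose l : ℝ) * Ca * ((i - l).factorial * Cg * (1 + CS) ^ (i - l)))
    (fun i _ => by positivity) (by simp; omega)

end

end StepTwo

/-! ### Dyadic partition of unity in τ and the localized kernel -/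

namespace StepTwo

noncomputable section

/-- A smooth radial bump, equal to one on the unit ball and supported in the ball of radius two. -/
def bump (r : ℕ) : ContDiffBump (0 : Centre r) := ⟨1, 2, one_pos, one_lt_two⟩

/-- A smooth function supported in an annulus whose dilates form a partition of unity. -/
def cutoff {r : ℕ} (τ : Centre r) : ℝ := bump r τ - bump r ((4 : ℝ) • τ)

theorem contDiff_cutoff {r : ℕ} (N : ℕ) : ContDiff ℝ N (cutoff (r := r)) := by
  have h : ContDiff ℝ N (bump r) := (bump r).contDiff
  exact h.sub (h.comp (contDiff_const_smul (4 : ℝ)))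

/-- The annulus that contains the support of `cutoff`. -/
def annulus (r : ℕ) : Set (Centre r) := Metric.closedBall 0 2 \ Metric.ball 0 (1 / 4)

theorem isCompact_annulus (r : ℕ) : IsCompact (annulus r) :=
  (isCompact_closedBall _ _).diff Metric.isOpen_ball

theorem mem_annulus {r : ℕ} {τ : Centre r} : τ ∈ annulus r ↔ ‖τ‖ ≤ 2 ∧ 1 / 4 ≤ ‖τ‖ := by
  simp [annulus]

theorem cutoff_eq_zero {r : ℕ} {τ : Centre r} (h : τ ∉ annulus r) : cutoff τ = 0 := by
  have h4 : ‖(4 : ℝ) • τ‖ = 4 * ‖τ‖ := by rw [norm_smul]; norm_num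
  rw [mem_annulus, not_and_or, not_le, not_le] at h
  rw [cutoff]
  rcases h with h | h
  · rw [(bump r).zero_of_le_dist, (bump r).zero_of_le_dist, sub_zero]
    · rw [dist_zero_right, h4]; simp only [bump]; linarith
    · rw [dist_zero_right]; exact h.le
  · rw [(bump r).one_of_mem_closedBall, (bump r).one_of_mem_closedBall, sub_self]
    · rw [mem_closedBall_zero_iff, h4]; simp only [bump]; linarith
    · rw [mem_closedBall_zero_iff]; simp only [bump]; linarith

/-- A telescoping sum over the exponents -N, …, N. The ratio is 4 = 2² because the dilation by 2
acts on the centre by 4. -/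
theorem sum_cutoff {r : ℕ} (N : ℕ) (τ : Centre r) :
    ∑ j ∈ Finset.range (2 * N + 1), cutoff ((4 : ℝ) ^ ((j : ℤ) - N) • τ) =
      bump r ((4 : ℝ) ^ (-(N : ℤ)) • τ) - bump r ((4 : ℝ) ^ ((N : ℤ) + 1) • τ) := by
  have h := Finset.sum_range_sub' (fun j : ℕ => bump r ((4 : ℝ) ^ ((j : ℤ) - N) • τ)) (2 * N + 1)
  have h1 : ((2 * N + 1 : ℕ) : ℤ) - N = N + 1 := by push_cast; ring
  simp only [h1, CharP.cast_eq_zero, zero_sub] at h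
  rw [← h]
  refine Finset.sum_congr rfl fun j _ => ?_
  rw [cutoff, smul_smul, ← zpow_one_add₀ (by norm_num)]
  congr 4
  push_cast; ring

theorem tendsto_sum_cutoff {r : ℕ} {τ : Centre r} (hτ : τ ≠ 0) :
    Tendsto (fun N : ℕ => ∑ j ∈ Finset.range (2 * N + 1), cutoff ((4 : ℝ) ^ ((j : ℤ) - N) • τ))
      atTop (𝓝 1) := by
  have hτ0 : 0 < ‖τ‖ := norm_pos_iff.2 hτ
  have h1 : ∀ᶠ N : ℕ in atTop, ‖τ‖ ≤ 4 ^ N ∧ 2 * ‖τ‖⁻¹ ≤ 4 ^ N :=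
    ((tendsto_pow_atTop_atTop_of_one_lt (by norm_num)).eventually_ge_atTop _).and
    ((tendsto_pow_atTop_atTop_of_one_lt (by norm_num)).eventually_ge_atTop _)
  refine tendsto_const_nhds.congr' ?_
  filter_upwards [h1] with N hN
  rw [sum_cutoff, (bump r).one_of_mem_closedBall, (bump r).zero_of_le_dist, sub_zero]
  · rw [dist_zero_right, norm_smul, norm_zpow, Real.norm_of_nonneg (by norm_num)]
    have h2 : (4 : ℝ) ^ ((N : ℤ) + 1) = 4 ^ N * 4 := by
      rw [zpow_add_one₀ (by norm_num), zpow_natCast]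
    rw [h2]
    have h3 := hN.2
    rw [← div_eq_mul_inv, div_le_iff₀ hτ0] at h3
    simp only [bump]
    nlinarith
  · rw [mem_closedBall_zero_iff, norm_smul, norm_zpow, Real.norm_of_nonneg (by norm_num), zpow_neg,
      zpow_natCast]
    simp only [bump]
    rw [inv_mul_le_iff₀ (by positivity), mul_one]
    exact hN.1

theorem abs_sum_cutoff_le {r : ℕ} (N : ℕ) (τ : Centre r) :
    |∑ j ∈ Finset.range (2 * N + 1), cutoff ((4 : ℝ) ^ ((j : ℤ) - N) • τ)| ≤ 1 := by
  rw [sum_cutoff, abs_le]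
  constructor
  · linarith [(bump r).nonneg (x := (4 : ℝ) ^ (-(N : ℤ)) • τ),
      (bump r).le_one (x := (4 : ℝ) ^ ((N : ℤ) + 1) • τ)]
  · linarith [(bump r).nonneg (x := (4 : ℝ) ^ ((N : ℤ) + 1) • τ),
      (bump r).le_one (x := (4 : ℝ) ^ (-(N : ℤ)) • τ)]

variable {n r : ℕ} {B : Fin r → Matrix (Fin (2 * n)) (Fin (2 * n)) ℝ}
variable (F : ∀ ω : Centre r, NormalFrame (BTau B ω)) (m : ℕ)

/-- The cutoff removes the singularity at τ = 0, so r + 1 integrations by parts give the decay in t,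
and the Gaussian gives any decay in y. The exponents 2n + 1 and r + 1 are the least integers that
make the product integrable. -/
theorem IsNondegenerate.exists_norm_weightedPm_cutoff_le (hB : IsNondegenerate B) :
    ∃ C : ℝ, 0 ≤ C ∧ ∀ x : Space n r, ‖weightedPm F m cutoff x‖ ≤
      C * (((1 + ‖x.1‖) ^ (2 * n + 1))⁻¹ * ((1 + ‖x.2‖) ^ (r + 1))⁻¹) := by
  obtain ⟨p, hp⟩ := exists_Qm_eq n m
  obtain ⟨c, hc, hcs⟩ := hB.exists_le_specVal
  set N := r + 1 with hN
  set U : Set (Centre r) := {τ | τ ≠ 0} with hUdef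
  have hU : IsOpen U := isOpen_ne
  have hAU : annulus r ⊆ U := by
    intro τ hτ
    rw [mem_annulus] at hτ
    have : 0 < ‖τ‖ := by linarith [hτ.2]
    exact norm_pos_iff.1 this
  obtain ⟨C, hC, hbd⟩ := exists_iteratedFDeriv_mul_comp_le (E := Horiz n) hU
    (isCompact_annulus r) hAU N (a := fun τ => cutoff τ * ∏ j, specVal F τ j) (S := absOp F)
    (fun τ hτ => ((contDiff_cutoff N).contDiffAt.mul
      (hB.contDiffAt_prod_specVal F hτ N)).contDiffWithinAt)
    (fun τ hτ => by simp only [cutoff_eq_zero hτ, zero_mul])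
    (fun τ hτ => (hB.contDiffAt_absOp F hτ N).contDiffWithinAt) p
    (c := c * (1 / 4)) (by positivity) (fun τ hτ y => by
      rw [inner_absOp_self]
      refine le_trans ?_ (le_quad F (hcs F) y τ)
      gcongr
      exact (mem_annulus.1 hτ).2)
  obtain ⟨K, hK, hosc⟩ := pow_mul_norm_osc_le (r := r) N
  set V := (volume (annulus r)).toReal with hV
  set a := c * (1 / 4) / 2 with ha_def
  have ha : 0 < a := by positivity
  set M := (2 * N + (2 * n + 1)).factorial * Real.exp a / a ^ (2 * N + (2 * n + 1)) with hM
  have hM0 : 0 ≤ M := by positivity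
  -- The Gaussian is traded for an exponential by |y| ≤ |y|² + 1, at the cost of the factor e^a.
  have hyb : ∀ y : Horiz n, (1 + ‖y‖ ^ 2) ^ N * Real.exp (-(a * ‖y‖ ^ 2)) ≤
      (M * Real.exp a) * ((1 + ‖y‖) ^ (2 * n + 1))⁻¹ := by
    intro y
    rw [← div_eq_mul_inv, le_div_iff₀ (by positivity)]
    have h1 := pow_mul_exp_neg_le ha (2 * N + (2 * n + 1)) (norm_nonneg y)
    have h2 : (1 + ‖y‖ ^ 2) ^ N ≤ (1 + ‖y‖) ^ (2 * N) := by
      rw [pow_mul]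
      gcongr
      nlinarith [norm_nonneg y]
    have h3 : Real.exp (-(a * ‖y‖ ^ 2)) ≤ Real.exp (-(a * ‖y‖)) * Real.exp a := by
      rw [← Real.exp_add]
      gcongr
      nlinarith [sq_nonneg (‖y‖ - 1), norm_nonneg y]
    calc _ ≤ (1 + ‖y‖) ^ (2 * N) * (Real.exp (-(a * ‖y‖)) * Real.exp a) *
          (1 + ‖y‖) ^ (2 * n + 1) := by gcongr
      _ = ((1 + ‖y‖) ^ (2 * N + (2 * n + 1)) * Real.exp (-(a * ‖y‖))) * Real.exp a := by
          rw [pow_add _ (2 * N)]; ring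
      _ ≤ _ := by gcongr
  set P : ℝ := ‖(1 / (2 * Real.pi : ℂ) ^ r)‖ with hP
  refine ⟨P * (K * ((N + 1) * (V * (C * (M * Real.exp a))))), by positivity, fun x => ?_⟩
  set f : Centre r → ℝ := fun τ => cutoff τ * Qm F m x.1 τ with hf
  have hfe : f = fun τ => (cutoff τ * ∏ j, specVal F τ j) *
      (p.eval (inner ℝ (absOp F τ x.1) x.1) * Real.exp (-(inner ℝ (absOp F τ x.1) x.1))) := by
    funext τ
    simp only [hf, hp, inner_absOp_self, mul_assoc]
  have hfN : ContDiff ℝ N f := by rw [hfe]; exact (hbd x.1).1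
  set X := C * (1 + ‖x.1‖ ^ 2) ^ N * Real.exp (-(a * ‖x.1‖ ^ 2)) with hX
  have hX0 : 0 ≤ X := by positivity
  have hfb : ∀ i ≤ N, ∀ τ, ‖iteratedFDeriv ℝ i f τ‖ ≤ (annulus r).indicator (fun _ => X) τ := by
    rw [hfe]; exact (hbd x.1).2
  have hg : ∀ i ≤ N, ∀ τ, ‖iteratedFDeriv ℝ i (fun τ => (f τ : ℂ)) τ‖ =
      ‖iteratedFDeriv ℝ i f τ‖ := fun i hi τ =>
    Complex.ofRealLI.norm_iteratedFDeriv_comp_left (n := N) hfN.contDiffAt (by exact_mod_cast hi)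
  have hgN : ContDiff ℝ N (fun τ => (f τ : ℂ)) := Complex.ofRealCLM.contDiff.comp hfN
  have hind : Integrable ((annulus r).indicator (fun _ => X)) (volume : Measure (Centre r)) :=
    (integrable_indicator_iff (isCompact_annulus r).measurableSet).2
      (integrableOn_const (isCompact_annulus r).measure_ne_top)
  have hint : ∀ i ≤ N, Integrable (fun τ => ‖iteratedFDeriv ℝ i (fun τ => (f τ : ℂ)) τ‖) := by
    intro i hi
    refine hind.mono' ?_ (.of_forall fun τ => ?_)
    · exact (hgN.continuous_iteratedFDeriv (by exact_mod_cast hi)).norm.aestronglyMeasurable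
    · rw [norm_norm, hg i hi]; exact hfb i hi τ
  have hle : ∀ i ≤ N, ∫ τ, ‖iteratedFDeriv ℝ i (fun τ => (f τ : ℂ)) τ‖ ≤ V * X := by
    intro i hi
    refine (integral_mono (hint i hi) hind fun τ => ?_).trans (le_of_eq ?_)
    · simp only [hg i hi]; exact hfb i hi τ
    · rw [integral_indicator (isCompact_annulus r).measurableSet, setIntegral_const, smul_eq_mul]
      rfl
  have hmain := hosc (fun τ => (f τ : ℂ)) hgN hint x.2
  have hsum : ∑ i ∈ Finset.range (N + 1), ∫ τ, ‖iteratedFDeriv ℝ i (fun τ => (f τ : ℂ)) τ‖ ≤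
      (N + 1) * (V * X) := by
    refine (Finset.sum_le_sum fun i hi => hle i (by simp at hi; omega)).trans (le_of_eq ?_)
    simp
  have hXy : X ≤ C * (M * Real.exp a) * ((1 + ‖x.1‖) ^ (2 * n + 1))⁻¹ := by
    rw [hX, mul_assoc, mul_assoc]
    exact mul_le_mul_of_nonneg_left (hyb x.1) hC
  have e : weightedPm F m cutoff x =
      1 / (2 * Real.pi : ℂ) ^ r * osc (fun τ => (f τ : ℂ)) x.2 := rfl
  rw [e, norm_mul, ← hP]
  have hV0 : 0 ≤ V := ENNReal.toReal_nonneg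
  have hfin : ‖osc (fun τ => (f τ : ℂ)) x.2‖ ≤
      K * ((N + 1) * (V * X)) * ((1 + ‖x.2‖) ^ N)⁻¹ := by
    rw [← div_eq_mul_inv, le_div_iff₀ (by positivity), mul_comm]
    exact hmain.trans (by gcongr)
  calc P * ‖osc (fun τ => (f τ : ℂ)) x.2‖
      ≤ P * (K * ((N + 1) * (V * (C * (M * Real.exp a) * ((1 + ‖x.1‖) ^ (2 * n + 1))⁻¹))) *
          ((1 + ‖x.2‖) ^ N)⁻¹) := by
        refine mul_le_mul_of_nonneg_left (hfin.trans ?_) (norm_nonneg _)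
        gcongr
    _ = _ := by ring

theorem IsNondegenerate.integrable_weightedPm_cutoff (hB : IsNondegenerate B) :
    Integrable (weightedPm F m cutoff) := by
  obtain ⟨C, hC, h⟩ := hB.exists_norm_weightedPm_cutoff_le F m
  have h1 : Integrable (fun x : Space n r =>
      ((1 + ‖x.1‖) ^ (2 * n + 1))⁻¹ * ((1 + ‖x.2‖) ^ (r + 1))⁻¹) :=
    (integrable_inv_one_add_norm_pow (volume : Measure (Horiz n)) (by simp)).mul_prod
      (integrable_inv_one_add_norm_pow (volume : Measure (Centre r)) (by simp))
  refine (h1.const_mul C).mono' ?_ (.of_forall h)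
  exact (hB.stronglyMeasurable_weightedPm F m
    (contDiff_cutoff 0).continuous.measurable).aestronglyMeasurable

end

end StepTwo

/-! ### Homogeneous shells and the integrability of P_m on a shell -/

namespace StepTwo

noncomputable section

variable {n r : ℕ}

theorem homNorm_nonneg (x : Space n r) : 0 ≤ homNorm x := by
  unfold homNorm; positivity

theorem homNorm_pow_four (x : Space n r) : homNorm x ^ 4 = ‖x.1‖ ^ 4 + ‖x.2‖ ^ 2 := by
  rw [homNorm, ← Real.rpow_natCast, ← Real.rpow_mul (by positivity)]
  norm_num

theorem continuous_homNorm : Continuous (homNorm : Space n r → ℝ) := by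
  unfold homNorm
  exact Continuous.rpow_const (by fun_prop) fun _ => Or.inr (by norm_num)

theorem homNorm_dil {c : ℝ} (hc : 0 ≤ c) (x : Space n r) : homNorm (dil c x) = c * homNorm x := by
  have h := homNorm_nonneg x
  refine (pow_left_inj₀ (homNorm_nonneg _) (by positivity) (by norm_num : (4 : ℕ) ≠ 0)).1 ?_
  rw [mul_pow, homNorm_pow_four, homNorm_pow_four, dil, norm_smul, norm_smul,
    Real.norm_of_nonneg hc, Real.norm_of_nonneg (by positivity)]
  ring

theorem norm_fst_le_homNorm (x : Space n r) : ‖x.1‖ ≤ homNorm x := by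
  refine (pow_le_pow_iff_left₀ (norm_nonneg _) (homNorm_nonneg _) (by norm_num : (4 : ℕ) ≠ 0)).1 ?_
  rw [homNorm_pow_four]
  nlinarith [sq_nonneg ‖x.2‖]

theorem norm_snd_le_homNorm_sq (x : Space n r) : ‖x.2‖ ≤ homNorm x ^ 2 := by
  refine (pow_le_pow_iff_left₀ (norm_nonneg _) (by positivity) (by norm_num : (2 : ℕ) ≠ 0)).1 ?_
  rw [← pow_mul, homNorm_pow_four]
  nlinarith [pow_nonneg (norm_nonneg x.1) 4]

theorem homNorm_eq_zero_iff (x : Space n r) : homNorm x = 0 ↔ x = 0 := by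
  constructor
  · intro h
    have h1 := norm_fst_le_homNorm x
    have h2 := norm_snd_le_homNorm_sq x
    rw [h] at h1 h2
    have h3 : x.1 = 0 := by simpa using h1
    have h4 : x.2 = 0 := by simpa using h2
    exact Prod.ext h3 h4
  · rintro rfl
    simp [homNorm]

theorem homNorm_pos {x : Space n r} (hx : x ≠ 0) : 0 < homNorm x :=
  (homNorm_nonneg x).lt_of_ne' fun h => hx ((homNorm_eq_zero_iff x).1 h)

theorem homNorm_le_one_add_norm (x : Space n r) : homNorm x ≤ 1 + ‖x‖ := by
  refine (pow_le_pow_iff_left₀ (homNorm_nonneg _) (by positivity) (by norm_num : (4 : ℕ) ≠ 0)).1 ?_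
  rw [homNorm_pow_four]
  have h1 : ‖x.1‖ ≤ ‖x‖ := norm_fst_le x
  have h2 : ‖x.2‖ ≤ ‖x‖ := norm_snd_le x
  calc ‖x.1‖ ^ 4 + ‖x.2‖ ^ 2 ≤ ‖x‖ ^ 4 + ‖x‖ ^ 2 := by gcongr
    _ ≤ (1 + ‖x‖) ^ 4 := by
      nlinarith [norm_nonneg x, pow_nonneg (norm_nonneg x) 3, pow_nonneg (norm_nonneg x) 2]

theorem norm_le_homNorm {x : Space n r} (hx : homNorm x ≤ 1) : ‖x‖ ≤ homNorm x := by
  refine max_le (norm_fst_le_homNorm x) ((norm_snd_le_homNorm_sq x).trans ?_)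
  nlinarith [homNorm_nonneg x]

/-- The dilation by a nonzero factor as a homeomorphism. -/
def dilHomeomorph {c : ℝ} (hc : c ≠ 0) : Space n r ≃ₜ Space n r :=
  (Homeomorph.smulOfNeZero c hc).prodCongr (Homeomorph.smulOfNeZero (c ^ 2) (pow_ne_zero 2 hc))

theorem coe_dilHomeomorph {c : ℝ} (hc : c ≠ 0) : ⇑(dilHomeomorph (n := n) (r := r) hc) = dil c :=
  rfl

theorem measurableEmbedding_dil {c : ℝ} (hc : c ≠ 0) :
    MeasurableEmbedding (dil c : Space n r → Space n r) := by
  rw [← coe_dilHomeomorph hc]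
  exact (dilHomeomorph hc).measurableEmbedding

theorem map_dil_volume {c : ℝ} (hc : 0 < c) :
    Measure.map (dil c : Space n r → Space n r) volume =
      ENNReal.ofReal ((c ^ (2 * n + 2 * r))⁻¹) • volume := by
  have h : (dil c : Space n r → Space n r) = Prod.map (c • ·) (c ^ 2 • ·) := rfl
  rw [h, Measure.volume_eq_prod, ← Measure.map_prod_map _ _ (measurable_const_smul c)
    (measurable_const_smul (c ^ 2)), Measure.map_addHaar_smul _ hc.ne',
    Measure.map_addHaar_smul _ (pow_ne_zero 2 hc.ne'), Measure.prod_smul_left,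
    Measure.prod_smul_right, smul_smul, finrank_euclideanSpace, finrank_euclideanSpace,
    Fintype.card_fin, Fintype.card_fin, abs_of_nonneg (by positivity), abs_of_nonneg (by positivity),
    ← ENNReal.ofReal_mul (by positivity)]
  congr 2
  rw [← mul_inv, ← pow_mul, ← pow_add]

theorem lintegral_comp_dil {c : ℝ} (hc : 0 < c) (g : Space n r → ℝ≥0∞) :
    ∫⁻ x, g (dil c x) = ENNReal.ofReal ((c ^ (2 * n + 2 * r))⁻¹) * ∫⁻ x, g x := by
  rw [← (measurableEmbedding_dil hc.ne').lintegral_map, map_dil_volume hc, lintegral_smul_measure,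
    smul_eq_mul]

/-- The homogeneous shell `a < |x| ≤ b`. -/
def shell (n r : ℕ) (a b : ℝ) : Set (Space n r) := homNorm ⁻¹' Set.Ioc a b

theorem measurableSet_shell (a b : ℝ) : MeasurableSet (shell n r a b) :=
  continuous_homNorm.measurable measurableSet_Ioc

theorem dil_mem_shell {c : ℝ} (hc : 0 < c) {a b : ℝ} {x : Space n r} :
    dil c x ∈ shell n r (c * a) (c * b) ↔ x ∈ shell n r a b := by
  simp only [shell, Set.mem_preimage, homNorm_dil hc.le, Set.mem_Ioc]
  rw [mul_lt_mul_iff_right₀ hc, mul_le_mul_iff_right₀ hc]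

theorem lintegral_shell_dil {c : ℝ} (hc : 0 < c) (a b : ℝ) (g : Space n r → ℝ≥0∞) :
    ∫⁻ x in shell n r a b, ENNReal.ofReal (c ^ (2 * n + 2 * r)) * g (dil c x) =
      ∫⁻ x in shell n r (c * a) (c * b), g x := by
  rw [← lintegral_indicator (measurableSet_shell a b),
    ← lintegral_indicator (measurableSet_shell (c * a) (c * b))]
  have h := lintegral_comp_dil hc (fun x => ENNReal.ofReal (c ^ (2 * n + 2 * r)) *
    (shell n r (c * a) (c * b)).indicator g x)
  have h2 : ∀ x : Space n r, ENNReal.ofReal (c ^ (2 * n + 2 * r)) *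
      (shell n r (c * a) (c * b)).indicator g (dil c x) =
      (shell n r a b).indicator
        (fun x => ENNReal.ofReal (c ^ (2 * n + 2 * r)) * g (dil c x)) x := by
    intro x
    by_cases hx : x ∈ shell n r a b
    · rw [Set.indicator_of_mem hx, Set.indicator_of_mem ((dil_mem_shell hc).2 hx)]
    · rw [Set.indicator_of_notMem hx, Set.indicator_of_notMem (mt (dil_mem_shell hc).1 hx), mul_zero]
  simp only [h2] at h
  rw [h, lintegral_const_mul' _ _ ENNReal.ofReal_ne_top, ← mul_assoc,
    ← ENNReal.ofReal_mul (by positivity), inv_mul_cancel₀ (by positivity), ENNReal.ofReal_one,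
    one_mul]

theorem lintegral_zpow_shells_le (g : Space n r → ℝ≥0∞) :
    ∑' i : ℤ, ∫⁻ x in shell n r (2 ^ i) (2 ^ (i + 1)), g x ≤ ∫⁻ x, g x := by
  rw [← lintegral_iUnion (fun i => measurableSet_shell _ _)]
  · exact setLIntegral_le_lintegral _ _
  · intro i j hij
    have hmono : Monotone fun i : ℤ => (2 : ℝ) ^ i := zpow_right_mono₀ one_le_two
    exact (hmono.pairwise_disjoint_on_Ioc_succ hij).preimage _

variable {B : Fin r → Matrix (Fin (2 * n)) (Fin (2 * n)) ℝ}
variable (F : ∀ ω : Centre r, NormalFrame (BTau B ω)) (m : ℕ)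

/-- The i-th dyadic piece is the L¹-normalised dilate of a single kernel, with c = 2^{-i} in
`weightedPm_dil`. -/
theorem enorm_weightedPm_cutoff_dil (i : ℤ) (x : Space n r) :
    ‖weightedPm F m (fun τ => cutoff ((4 : ℝ) ^ i • τ)) x‖ₑ =
      ENNReal.ofReal (((2 : ℝ) ^ (-i)) ^ (2 * n + 2 * r)) *
        ‖weightedPm F m cutoff (dil ((2 : ℝ) ^ (-i)) x)‖ₑ := by
  have hc : (0 : ℝ) < (2 : ℝ) ^ (-i) := by positivity
  have h4 : (((2 : ℝ) ^ (-i)) ^ 2)⁻¹ = (4 : ℝ) ^ i := by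
    rw [← zpow_natCast, ← zpow_mul, ← zpow_neg, show (4 : ℝ) = 2 ^ (2 : ℤ) by norm_num, ← zpow_mul]
    congr 1
    push_cast
    ring
  rw [weightedPm_dil F m hc, enorm_mul, ← ofReal_norm, ← ofReal_norm, Complex.norm_real,
    Real.norm_of_nonneg (by positivity), ← mul_assoc, ← ENNReal.ofReal_mul (by positivity),
    mul_inv_cancel₀ (by positivity), ENNReal.ofReal_one, one_mul, h4, ofReal_norm]

theorem IsNondegenerate.integrable_weighted_integrand (hB : IsNondegenerate B) {x : Space n r}
    (hx : x.1 ≠ 0) {w : Centre r → ℝ} (hw : Measurable w) {M : ℝ} (hM : ∀ τ, |w τ| ≤ M) :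
    Integrable (fun τ : Centre r => Complex.exp (Complex.I * (inner ℝ x.2 τ : ℝ)) *
      ((w τ * Qm F m x.1 τ : ℝ) : ℂ)) := by
  refine ((hB.integrable_Qm F m hx).norm.const_mul M).mono' ?_ (.of_forall fun τ => ?_)
  · refine Measurable.aestronglyMeasurable ?_
    refine Measurable.mul (Continuous.measurable (by fun_prop)) ?_
    exact Complex.measurable_ofReal.comp (hw.mul (hB.measurable_Qm_right F m x.1))
  · rw [norm_mul, norm_exp_I_mul, one_mul, Complex.norm_real, norm_mul]
    gcongr
    exact hM τ

theorem abs_cutoff_le {r : ℕ} (τ : Centre r) : |cutoff τ| ≤ 1 := by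
  rw [cutoff, abs_le]
  constructor
  · linarith [(bump r).nonneg (x := τ), (bump r).le_one (x := (4 : ℝ) • τ)]
  · linarith [(bump r).nonneg (x := (4 : ℝ) • τ), (bump r).le_one (x := τ)]

theorem IsNondegenerate.tendsto_sum_weightedPm (hB : IsNondegenerate B) {x : Space n r}
    (hx : x.1 ≠ 0) : Tendsto (fun N : ℕ => ∑ j ∈ Finset.range (2 * N + 1),
      weightedPm F m (fun τ => cutoff ((4 : ℝ) ^ ((j : ℤ) - N) • τ)) x) atTop
      (𝓝 (PmAux F m x)) := by
  have hcm : ∀ i : ℤ, Measurable fun τ : Centre r => cutoff ((4 : ℝ) ^ i • τ) := fun i =>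
    ((contDiff_cutoff 0).continuous.comp (continuous_const_smul _)).measurable
  have h1 : ∀ N : ℕ, ∑ j ∈ Finset.range (2 * N + 1),
      weightedPm F m (fun τ => cutoff ((4 : ℝ) ^ ((j : ℤ) - N) • τ)) x =
      weightedPm F m (fun τ => ∑ j ∈ Finset.range (2 * N + 1),
        cutoff ((4 : ℝ) ^ ((j : ℤ) - N) • τ)) x := by
    intro N
    simp only [weightedPm]
    rw [← Finset.mul_sum, ← integral_finsetSum _ fun j _ =>
      hB.integrable_weighted_integrand F m hx (hcm _) fun τ => abs_cutoff_le _]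
    simp only [← Finset.mul_sum, Finset.sum_mul, Complex.ofReal_sum]
  simp only [h1]
  rw [← weightedPm_one]
  simp only [weightedPm]
  refine Tendsto.const_mul _ ?_
  refine tendsto_integral_of_dominated_convergence (fun τ => ‖Qm F m x.1 τ‖) (fun N => ?_)
    (hB.integrable_Qm F m hx).norm (fun N => .of_forall fun τ => ?_) ?_
  · exact (hB.integrable_weighted_integrand F m hx
      (Finset.measurable_sum _ fun j _ => hcm _) (abs_sum_cutoff_le N)).aestronglyMeasurable
  · rw [norm_mul, norm_exp_I_mul, one_mul, Complex.norm_real, norm_mul]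
    have := abs_sum_cutoff_le N τ
    rw [← Real.norm_eq_abs] at this
    exact mul_le_of_le_one_left (norm_nonneg _) this
  · refine .of_forall fun τ => ?_
    refine Tendsto.const_mul _ ((Complex.continuous_ofReal.tendsto _).comp ?_)
    -- At τ = 0 the cutoffs sum to 0 rather than 1, which is harmless because Q_m vanishes there.
    by_cases hτ : τ = 0
    · simp [hτ, Qm_zero F m hB.horiz_pos]
    · exact (tendsto_sum_cutoff hτ).mul_const _

theorem IsNondegenerate.enorm_PmAux_le (hB : IsNondegenerate B) {x : Space n r} (hx : x.1 ≠ 0) :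
    ‖PmAux F m x‖ₑ ≤ ∑' i : ℤ, ‖weightedPm F m (fun τ => cutoff ((4 : ℝ) ^ i • τ)) x‖ₑ := by
  refine le_of_tendsto (hB.tendsto_sum_weightedPm F m hx).enorm (.of_forall fun N => ?_)
  refine (enorm_sum_le _ _).trans ?_
  have hinj : Function.Injective fun j : ℕ => (j : ℤ) - N := fun a b h => by simpa using h
  have h := Finset.sum_map (Finset.range (2 * N + 1)) ⟨_, hinj⟩
    (fun i => ‖weightedPm F m (fun τ => cutoff ((4 : ℝ) ^ i • τ)) x‖ₑ)
  exact h.symm.trans_le (ENNReal.sum_le_tsum _)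

theorem ae_fst_ne_zero (hn : 0 < n) : ∀ᵐ x : Space n r, x.1 ≠ 0 := by
  have : Nonempty (Fin (2 * n)) := ⟨⟨0, by omega⟩⟩
  have h : ∀ᵐ y : Horiz n, y ≠ 0 := Measure.ae_ne volume 0
  exact Measure.quasiMeasurePreserving_fst.ae h

/-- `P_m` is integrable over a shell. -/
theorem IsNondegenerate.lintegral_shell_PmAux_lt_top (hB : IsNondegenerate B) :
    ∫⁻ x in shell n r 1 2, ‖PmAux F m x‖ₑ < ∞ := by
  have hm : ∀ i : ℤ, Measurable fun x : Space n r =>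
      ‖weightedPm F m (fun τ => cutoff ((4 : ℝ) ^ i • τ)) x‖ₑ := fun i =>
    (hB.stronglyMeasurable_weightedPm F m ((contDiff_cutoff 0).continuous.comp
      (continuous_const_smul _)).measurable).measurable.enorm
  calc ∫⁻ x in shell n r 1 2, ‖PmAux F m x‖ₑ
      ≤ ∫⁻ x in shell n r 1 2,
          ∑' i : ℤ, ‖weightedPm F m (fun τ => cutoff ((4 : ℝ) ^ i • τ)) x‖ₑ := by
        refine lintegral_mono_ae (ae_restrict_of_ae ?_)
        filter_upwards [ae_fst_ne_zero hB.horiz_pos] with x hx using hB.enorm_PmAux_le F m hx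
    _ = ∑' i : ℤ, ∫⁻ x in shell n r 1 2,
          ‖weightedPm F m (fun τ => cutoff ((4 : ℝ) ^ i • τ)) x‖ₑ :=
        lintegral_tsum fun i => (hm i).aemeasurable
    -- Fixed shell and varying dilates become fixed kernel and varying shells. The latter are
    -- disjoint, so the whole sum costs only one L¹ norm.
    _ = ∑' i : ℤ, ∫⁻ x in shell n r (2 ^ (-i)) (2 ^ (-i + 1)), ‖weightedPm F m cutoff x‖ₑ := by
        refine tsum_congr fun i => ?_
        simp only [enorm_weightedPm_cutoff_dil]
        rw [lintegral_shell_dil (by positivity) 1 2 (fun x => ‖weightedPm F m cutoff x‖ₑ), mul_one,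
          zpow_add_one₀ two_ne_zero]
    _ = ∑' i : ℤ, ∫⁻ x in shell n r (2 ^ i) (2 ^ (i + 1)), ‖weightedPm F m cutoff x‖ₑ :=
        (Equiv.neg ℤ).tsum_eq (fun i : ℤ => ∫⁻ x in shell n r (2 ^ i) (2 ^ (i + 1)),
          ‖weightedPm F m cutoff x‖ₑ)
    _ ≤ ∫⁻ x, ‖weightedPm F m cutoff x‖ₑ := lintegral_zpow_shells_le _
    _ < ∞ := (hB.integrable_weightedPm_cutoff F m).hasFiniteIntegral

end

end StepTwo

/-! ### Kernels of critical homogeneity: absolute convergence near and away from the origin -/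

namespace StepTwo

noncomputable section

variable {n r : ℕ}

/-- A kernel that is homogeneous of the critical degree `-(2n + 2r)`, integrable over a shell and
bounded on each fibre `{y} × ℝ^r` with `y ≠ 0`. -/
structure IsCriticalKernel (K : Space n r → ℂ) : Prop where
  stronglyMeasurable : StronglyMeasurable K
  dil : ∀ c : ℝ, 0 < c → ∀ x, K (dil c x) = ((c ^ (2 * n + 2 * r))⁻¹ : ℝ) * K x
  shell_lt_top : ∫⁻ x in shell n r 1 2, ‖K x‖ₑ < ∞
  bounded_fibre : ∀ y : Horiz n, y ≠ 0 → ∃ M : ℝ, ∀ t, ‖K (y, t)‖ ≤ M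

theorem measurableSet_homBall (ε : ℝ) : MeasurableSet (homBall n r ε) :=
  continuous_homNorm.measurable measurableSet_Iic

theorem mem_homBall_compl {ε : ℝ} {x : Space n r} : x ∈ (homBall n r ε)ᶜ ↔ ε < homNorm x := by
  simp [homBall]

variable {K : Space n r → ℂ}

namespace IsCriticalKernel

theorem enorm_dil (hK : IsCriticalKernel K) {c : ℝ} (hc : 0 < c) (x : Space n r) :
    ENNReal.ofReal (c ^ (2 * n + 2 * r)) * ‖K (StepTwo.dil c x)‖ₑ = ‖K x‖ₑ := by
  rw [hK.dil c hc, enorm_mul, ← ofReal_norm, ← ofReal_norm, Complex.norm_real,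
    Real.norm_of_nonneg (by positivity), ← mul_assoc, ← ENNReal.ofReal_mul (by positivity),
    mul_inv_cancel₀ (by positivity), ENNReal.ofReal_one, one_mul]

theorem lintegral_shell (hK : IsCriticalKernel K) {a : ℝ} (ha : 0 < a) :
    ∫⁻ x in shell n r a (2 * a), ‖K x‖ₑ = ∫⁻ x in shell n r 1 2, ‖K x‖ₑ := by
  have h := lintegral_shell_dil (n := n) (r := r) ha 1 2 (fun x => ‖K x‖ₑ)
  simp only [hK.enorm_dil ha, mul_one] at h
  rw [h, mul_comm a]

/-- At the critical degree all shells (a, 2a] carry the same mass of K, so any factor that decays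
geometrically from shell to shell is enough for convergence. -/
theorem lintegral_le_of_subset_iUnion (hK : IsCriticalKernel K) {s : Set (Space n r)} {a : ℕ → ℝ}
    (ha : ∀ i, 0 < a i) (hs : s ⊆ ⋃ i, shell n r (a i) (2 * a i)) {f : Space n r → ℝ≥0∞} {M : ℝ≥0∞}
    (hf : ∀ i, ∀ x ∈ shell n r (a i) (2 * a i), f x ≤ M * 2⁻¹ ^ i) :
    ∫⁻ x in s, f x * ‖K x‖ₑ ≤ M * 2 * ∫⁻ x in shell n r 1 2, ‖K x‖ₑ := by
  calc ∫⁻ x in s, f x * ‖K x‖ₑ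
      ≤ ∫⁻ x in ⋃ i, shell n r (a i) (2 * a i), f x * ‖K x‖ₑ := lintegral_mono_set hs
    _ ≤ ∑' i, ∫⁻ x in shell n r (a i) (2 * a i), f x * ‖K x‖ₑ := lintegral_iUnion_le _ _
    _ ≤ ∑' i, ∫⁻ x in shell n r (a i) (2 * a i), M * 2⁻¹ ^ i * ‖K x‖ₑ := by
        refine ENNReal.tsum_le_tsum fun i => ?_
        refine setLIntegral_mono' (measurableSet_shell _ _) fun x hx => ?_
        gcongr
        exact hf i x hx
    _ = ∑' i : ℕ, M * 2⁻¹ ^ i * ∫⁻ x in shell n r 1 2, ‖K x‖ₑ := by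
        refine tsum_congr fun i => ?_
        rw [lintegral_const_mul _ hK.stronglyMeasurable.measurable.enorm, hK.lintegral_shell (ha i)]
    _ = _ := by
        rw [ENNReal.tsum_mul_right, ENNReal.tsum_mul_left, ENNReal.tsum_geometric,
          ENNReal.one_sub_inv_two, inv_inv]

theorem ofReal_half_pow (i : ℕ) : ENNReal.ofReal ((1 / 2) ^ i) = 2⁻¹ ^ i := by
  rw [ENNReal.ofReal_pow (by norm_num), one_div, ENNReal.ofReal_inv_of_pos two_pos,
    ENNReal.ofReal_ofNat]

/-- One power of the homogeneous norm gains a factor 1/2 per shell towards the origin. -/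
theorem lintegral_inner_le (hK : IsCriticalKernel K) {ε : ℝ} (hε : 0 < ε) :
    ∫⁻ x in shell n r 0 ε, ENNReal.ofReal (homNorm x) * ‖K x‖ₑ ≤
      ENNReal.ofReal ε * 2 * ∫⁻ x in shell n r 1 2, ‖K x‖ₑ := by
  have h2 : ∀ i : ℕ, 2 * ((1 / 2 : ℝ) ^ (i + 1) * ε) = (1 / 2) ^ i * ε := fun i => by
    rw [pow_succ]; ring
  refine hK.lintegral_le_of_subset_iUnion (a := fun i => (1 / 2) ^ (i + 1) * ε)
    (fun i => by positivity) (fun x hx => ?_) (fun i x hx => ?_)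
  · obtain ⟨h0, h1⟩ := hx
    obtain ⟨i, hi1, hi2⟩ := exists_nat_pow_near_of_lt_one (x := homNorm x / ε) (y := 1 / 2)
      (by positivity) ((div_le_one hε).2 h1) (by norm_num) (by norm_num)
    rw [lt_div_iff₀ hε] at hi1
    rw [div_le_iff₀ hε] at hi2
    exact Set.mem_iUnion.2 ⟨i, hi1, by rw [h2]; exact hi2⟩
  · rw [← ofReal_half_pow, ← ENNReal.ofReal_mul hε.le]
    refine ENNReal.ofReal_le_ofReal ?_
    have := hx.2
    rw [h2] at this
    linarith

/-- The counterpart at infinity: one inverse power gains 1/2 per outward shell. -/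
theorem lintegral_outer_le (hK : IsCriticalKernel K) {ε : ℝ} (hε : 0 < ε) :
    ∫⁻ x in (homBall n r ε)ᶜ, ENNReal.ofReal (homNorm x)⁻¹ * ‖K x‖ₑ ≤
      ENNReal.ofReal ε⁻¹ * 2 * ∫⁻ x in shell n r 1 2, ‖K x‖ₑ := by
  refine hK.lintegral_le_of_subset_iUnion (a := fun i => 2 ^ i * ε)
    (fun i => by positivity) (fun x hx => ?_) (fun i x hx => ?_)
  · rw [mem_homBall_compl] at hx
    have hx0 : 0 < homNorm x := hε.trans hx
    obtain ⟨i, hi1, hi2⟩ := exists_mem_Ioc_zpow (x := homNorm x / ε) (y := 2)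
      (by positivity) one_lt_two
    rw [lt_div_iff₀ hε] at hi1
    rw [div_le_iff₀ hε] at hi2
    have hi0 : 0 ≤ i := by
      by_contra! hneg
      have h3 : (2 : ℝ) ^ (i + 1) ≤ 2 ^ (0 : ℤ) := zpow_le_zpow_right₀ one_le_two (by omega)
      rw [zpow_zero] at h3
      nlinarith
    lift i to ℕ using hi0
    refine Set.mem_iUnion.2 ⟨i, by simpa using hi1, ?_⟩
    rw [zpow_add_one₀ two_ne_zero, zpow_natCast] at hi2
    linarith
  · rw [← ofReal_half_pow, ← ENNReal.ofReal_mul (by positivity)]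
    refine ENNReal.ofReal_le_ofReal ?_
    have h1 := hx.1
    have h4 : ε⁻¹ * (1 / 2) ^ i = (2 ^ i * ε)⁻¹ := by
      rw [one_div, inv_pow, mul_inv, mul_comm]
    rw [h4]
    exact inv_anti₀ (by positivity) h1.le

theorem integrableOn_homBall_compl (hK : IsCriticalKernel K) {f : Space n r → ℂ}
    (hf : Continuous f) {C : ℝ} (hC : ∀ x, homNorm x * ‖f x‖ ≤ C) {ε : ℝ} (hε : 0 < ε) :
    IntegrableOn (fun x => f x * K x) (homBall n r ε)ᶜ := by
  refine ⟨(hf.stronglyMeasurable.mul hK.stronglyMeasurable).aestronglyMeasurable, ?_⟩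
  have h1 : ∫⁻ x in (homBall n r ε)ᶜ, ‖f x * K x‖ₑ ≤
      ENNReal.ofReal C * ∫⁻ x in (homBall n r ε)ᶜ, ENNReal.ofReal (homNorm x)⁻¹ * ‖K x‖ₑ := by
    rw [← lintegral_const_mul' _ _ ENNReal.ofReal_ne_top]
    refine setLIntegral_mono' (measurableSet_homBall ε).compl fun x hx => ?_
    rw [mem_homBall_compl] at hx
    have hx0 : 0 < homNorm x := hε.trans hx
    rw [enorm_mul, ← mul_assoc, ← ENNReal.ofReal_mul' (by positivity)]
    gcongr
    rw [← ofReal_norm]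
    refine ENNReal.ofReal_le_ofReal ?_
    rw [← div_eq_mul_inv, le_div_iff₀ hx0, mul_comm]
    exact hC x
  exact h1.trans_lt (ENNReal.mul_lt_top ENNReal.ofReal_lt_top ((hK.lintegral_outer_le hε).trans_lt
    (ENNReal.mul_lt_top (ENNReal.mul_lt_top ENNReal.ofReal_lt_top (by simp)) hK.shell_lt_top)))

theorem homBall_ae_eq_shell (hn : 0 < n) (ε : ℝ) :
    (homBall n r ε : Set (Space n r)) =ᵐ[volume] shell n r 0 ε := by
  filter_upwards [ae_fst_ne_zero (r := r) hn] with x hx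
  have hx0 : x ≠ 0 := by rintro rfl; exact hx rfl
  have := homNorm_pos hx0
  refine propext ⟨fun h => ⟨this, h⟩, fun h => h.2⟩

theorem lintegral_homBall_le (hK : IsCriticalKernel K) (hn : 0 < n) {f : Space n r → ℂ} {C : ℝ}
    (hC0 : 0 ≤ C) {ε : ℝ} (hε : 0 < ε) (hC : ∀ x, homNorm x ≤ ε → ‖f x‖ ≤ C * homNorm x) :
    ∫⁻ x in homBall n r ε, ‖f x * K x‖ₑ ≤
      ENNReal.ofReal C * (ENNReal.ofReal ε * 2 * ∫⁻ x in shell n r 1 2, ‖K x‖ₑ) := by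
  rw [setLIntegral_congr (homBall_ae_eq_shell hn ε)]
  refine le_trans ?_ (mul_le_mul_right (hK.lintegral_inner_le hε) _)
  rw [← lintegral_const_mul' _ _ ENNReal.ofReal_ne_top]
  refine setLIntegral_mono' (measurableSet_shell 0 ε) fun x hx => ?_
  rw [enorm_mul, ← mul_assoc, ← ENNReal.ofReal_mul hC0]
  gcongr
  rw [← ofReal_norm]
  exact ENNReal.ofReal_le_ofReal (hC x hx.2)

theorem integrableOn_homBall (hK : IsCriticalKernel K) (hn : 0 < n) {f : Space n r → ℂ}
    (hf : Continuous f) {C : ℝ} (hC0 : 0 ≤ C) {ε : ℝ} (hε : 0 < ε)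
    (hC : ∀ x, homNorm x ≤ ε → ‖f x‖ ≤ C * homNorm x) :
    IntegrableOn (fun x => f x * K x) (homBall n r ε) := by
  refine ⟨(hf.stronglyMeasurable.mul hK.stronglyMeasurable).aestronglyMeasurable, ?_⟩
  exact (hK.lintegral_homBall_le hn hC0 hε hC).trans_lt (ENNReal.mul_lt_top ENNReal.ofReal_lt_top
    (ENNReal.mul_lt_top (ENNReal.mul_lt_top ENNReal.ofReal_lt_top (by simp)) hK.shell_lt_top))

theorem tendsto_integral_homBall (hK : IsCriticalKernel K) (hn : 0 < n) {f : Space n r → ℂ} {C : ℝ}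
    (hC0 : 0 ≤ C) (hC : ∀ x, homNorm x ≤ 1 → ‖f x‖ ≤ C * homNorm x) :
    Tendsto (fun ε : ℝ => ∫ x in homBall n r ε, f x * K x) (𝓝[>] 0) (𝓝 0) := by
  set A := (∫⁻ x in shell n r 1 2, ‖K x‖ₑ).toReal
  have hb : ∀ ε : ℝ, 0 < ε → ε ≤ 1 → ‖∫ x in homBall n r ε, f x * K x‖ ≤ C * (ε * 2 * A) := by
    intro ε hε hε1
    rw [← toReal_enorm]
    have h1 := (enorm_integral_le_lintegral_enorm _).trans
      (hK.lintegral_homBall_le hn hC0 hε fun x hx => hC x (hx.trans hε1))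
    refine (ENNReal.toReal_mono ?_ h1).trans (le_of_eq ?_)
    · exact (ENNReal.mul_lt_top ENNReal.ofReal_lt_top (ENNReal.mul_lt_top
        (ENNReal.mul_lt_top ENNReal.ofReal_lt_top (by simp)) hK.shell_lt_top)).ne
    · simp [ENNReal.toReal_mul, ENNReal.toReal_ofReal hC0, ENNReal.toReal_ofReal hε.le, A]
  have hlim : Tendsto (fun ε : ℝ => C * (ε * 2 * A)) (𝓝[>] 0) (𝓝 0) := by
    have : Continuous fun ε : ℝ => C * (ε * 2 * A) := by fun_prop
    simpa using (this.tendsto 0).mono_left nhdsWithin_le_nhds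
  refine squeeze_zero_norm' ?_ hlim
  filter_upwards [Ioc_mem_nhdsGT (zero_lt_one (α := ℝ))] with ε hε using hb ε hε.1 hε.2

theorem integrableOn_shell (hK : IsCriticalKernel K) {a b : ℝ} (ha : 0 < a) :
    IntegrableOn K (shell n r a b) := by
  refine ⟨hK.stronglyMeasurable.aestronglyMeasurable, ?_⟩
  have h1 : ∫⁻ x in shell n r a b, ‖K x‖ₑ ≤ ENNReal.ofReal b *
      ∫⁻ x in (homBall n r a)ᶜ, ENNReal.ofReal (homNorm x)⁻¹ * ‖K x‖ₑ := by
    have hs : shell n r a b ⊆ (homBall n r a)ᶜ := fun x hx => mem_homBall_compl.2 hx.1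
    refine le_trans ?_ (mul_le_mul_right (lintegral_mono_set hs) _)
    rw [← lintegral_const_mul' _ _ ENNReal.ofReal_ne_top]
    refine setLIntegral_mono' (measurableSet_shell a b) fun x hx => ?_
    have hx0 : 0 < homNorm x := ha.trans hx.1
    rw [← mul_assoc, ← ENNReal.ofReal_mul' (by positivity)]
    refine le_mul_of_one_le_left zero_le ?_
    rw [ENNReal.one_le_ofReal, ← div_eq_mul_inv, one_le_div hx0]
    exact hx.2
  exact h1.trans_lt (ENNReal.mul_lt_top ENNReal.ofReal_lt_top ((hK.lintegral_outer_le ha).trans_lt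
    (ENNReal.mul_lt_top (ENNReal.mul_lt_top ENNReal.ofReal_lt_top (by simp)) hK.shell_lt_top)))

end IsCriticalKernel

theorem exists_homNorm_mul_le (φ : 𝓢(Space n r, ℂ)) : ∃ C : ℝ, ∀ x, homNorm x * ‖φ x‖ ≤ C := by
  refine ⟨SchwartzMap.seminorm ℝ 0 0 φ + SchwartzMap.seminorm ℝ 1 0 φ, fun x => ?_⟩
  have h1 := φ.norm_le_seminorm ℝ x
  have h2 := φ.norm_pow_mul_le_seminorm ℝ 1 x
  have h3 := homNorm_le_one_add_norm x
  rw [pow_one] at h2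
  nlinarith [norm_nonneg (φ x)]

/-- The mean value inequality bounds the difference by ‖x‖, and inside the unit ball ‖x‖ is at most
the homogeneous norm. This is the one power that `lintegral_inner_le` needs. -/
theorem exists_norm_sub_le (φ : 𝓢(Space n r, ℂ)) : ∃ C : ℝ, 0 ≤ C ∧
    ∀ x : Space n r, homNorm x ≤ 1 → ‖φ x - φ 0‖ ≤ C * homNorm x := by
  refine ⟨SchwartzMap.seminorm ℝ 0 1 φ, apply_nonneg _ _, fun x hx => ?_⟩
  have h1 := (convex_univ (𝕜 := ℝ) (E := Space n r)).norm_image_sub_le_of_norm_fderiv_le (f := φ)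
    (C := SchwartzMap.seminorm ℝ 0 1 φ) (x := 0) (y := x) (fun z _ => φ.differentiableAt)
    (fun z _ => by
      have := φ.norm_iteratedFDeriv_le_seminorm ℝ 1 z
      rwa [norm_iteratedFDeriv_one] at this) (Set.mem_univ _) (Set.mem_univ _)
  rw [sub_zero] at h1
  exact h1.trans (mul_le_mul_of_nonneg_left (norm_le_homNorm hx) (apply_nonneg _ _))

end

end StepTwo

/-! ### Iterated integrals over balls: the constant C and vanishing shell integrals -/

namespace StepTwo

noncomputable section

variable {n r : ℕ} {K : Space n r → ℂ}

/-- The inner integral of the kernel over the fibre of the ball of radius `ε` above `y`. -/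
def fibreIntegral (K : Space n r → ℂ) (ε : ℝ) (y : Horiz n) : ℂ :=
  ∫ t : Centre r, (homBall n r ε).indicator K (y, t)

/-- The iterated integral of the kernel over the homogeneous unit ball. -/
def ballConstant (K : Space n r → ℂ) : ℂ := ∫ y : Horiz n, fibreIntegral K 1 y

theorem integrable_fibre (φ : 𝓢(Space n r, ℂ)) (y : Horiz n) :
    Integrable fun t : Centre r => φ (y, t) := by
  have h2 := φ.one_add_le_sup_seminorm_apply (𝕜 := ℝ) (m := (r + 1, 0)) (k := r + 1) (n := 0)
    le_rfl le_rfl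
  set D := 2 ^ (r + 1) * ((Finset.Iic (r + 1, 0)).sup
    fun m => SchwartzMap.seminorm ℝ m.1 m.2) φ
  refine ((integrable_inv_one_add_norm_pow (volume : Measure (Centre r)) (k := r + 1)
    (by simp)).const_mul D).mono'
    (by have := φ.continuous; exact Continuous.aestronglyMeasurable (by fun_prop))
    (.of_forall fun t => ?_)
  rw [← div_eq_mul_inv, le_div_iff₀ (by positivity), mul_comm]
  refine le_trans ?_ (h2 (y, t))
  rw [norm_iteratedFDeriv_zero]
  gcongr
  exact norm_snd_le (y, t)

namespace IsCriticalKernel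

/-- Rescale t by ε² and y by ε: the two Jacobians cancel the homogeneity factor exactly. Scaling of
Bochner integrals needs no integrability, so the identity holds before convergence is known. -/
theorem integral_fibreIntegral (hK : IsCriticalKernel K) {ε : ℝ} (hε : 0 < ε) :
    ∫ y : Horiz n, fibreIntegral K ε y = ballConstant K := by
  have h1 : ∀ (y : Horiz n) (t : Centre r), (homBall n r ε).indicator K (ε • y, ε ^ 2 • t) =
      ((ε ^ (2 * n + 2 * r))⁻¹ : ℝ) * (homBall n r 1).indicator K (y, t) := by
    intro y t
    have h2 : ((ε • y, ε ^ 2 • t) : Space n r) = StepTwo.dil ε (y, t) := rfl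
    have h3 : StepTwo.dil ε (y, t) ∈ homBall n r ε ↔ ((y, t) : Space n r) ∈ homBall n r 1 := by
      simp only [homBall, Set.mem_ofPred_eq, homNorm_dil hε.le]
      rw [mul_le_iff_le_one_right hε]
    rw [h2]
    by_cases hx : ((y, t) : Space n r) ∈ homBall n r 1
    · rw [Set.indicator_of_mem hx, Set.indicator_of_mem (h3.2 hx), hK.dil ε hε]
    · rw [Set.indicator_of_notMem hx, Set.indicator_of_notMem (mt h3.1 hx), mul_zero]
  have h4 : ∀ y : Horiz n, fibreIntegral K ε (ε • y) =
      ((ε ^ (2 * n))⁻¹ : ℝ) * fibreIntegral K 1 y := by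
    intro y
    have h5 := Measure.integral_comp_smul (volume : Measure (Centre r))
      (fun t => (homBall n r ε).indicator K (ε • y, t)) (ε ^ 2)
    simp only [h1, integral_const_mul] at h5
    rw [finrank_euclideanSpace, Fintype.card_fin, abs_of_nonneg (by positivity),
      Complex.real_smul, ← pow_mul] at h5
    rw [fibreIntegral, fibreIntegral]
    have h6 : ((ε ^ (2 * r) : ℝ) : ℂ) ≠ 0 := by exact_mod_cast (pow_pos hε _).ne'
    have h7 : ((ε ^ (2 * n) : ℝ) : ℂ) ≠ 0 := by exact_mod_cast (pow_pos hε _).ne'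
    rw [pow_add] at h5
    push_cast at h5 h6 h7 ⊢
    field_simp at h5 ⊢
    exact h5.symm
  have h5 := Measure.integral_comp_smul (volume : Measure (Horiz n)) (fibreIntegral K ε) ε
  simp only [h4, integral_const_mul] at h5
  rw [finrank_euclideanSpace, Fintype.card_fin, abs_of_nonneg (by positivity),
    Complex.real_smul] at h5
  have h7 : ((ε ^ (2 * n) : ℝ) : ℂ) ≠ 0 := by exact_mod_cast (pow_pos hε _).ne'
  rw [ballConstant]
  push_cast at h5 h7
  exact (mul_left_cancel₀ (inv_ne_zero h7) h5).symm

/-- K need not be integrable over the ball, but each fibre y ≠ 0 of the ball is bounded in t and K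
is bounded on it. -/
theorem integrable_fibre_homBall (hK : IsCriticalKernel K) (ε : ℝ) {y : Horiz n}
    (hy : y ≠ 0) : Integrable fun t : Centre r => (homBall n r ε).indicator K (y, t) := by
  obtain ⟨M, hM⟩ := hK.bounded_fibre y hy
  have h1 : IntegrableOn (fun _ : Centre r => M) (Metric.closedBall 0 (ε ^ 2)) :=
    integrableOn_const (isCompact_closedBall _ _).measure_ne_top
  refine ((integrable_indicator_iff Metric.isClosed_closedBall.measurableSet).2 h1).mono' ?_
    (.of_forall fun t => ?_)
  · exact ((hK.stronglyMeasurable.indicator (measurableSet_homBall ε)).comp_measurable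
      measurable_prodMk_left).aestronglyMeasurable
  · by_cases hx : ((y, t) : Space n r) ∈ homBall n r ε
    · have h2 : t ∈ Metric.closedBall (0 : Centre r) (ε ^ 2) := by
        rw [mem_closedBall_zero_iff]
        refine (norm_snd_le_homNorm_sq ((y, t) : Space n r)).trans ?_
        have h3 : homNorm ((y, t) : Space n r) ≤ ε := hx
        have := homNorm_nonneg ((y, t) : Space n r)
        gcongr
      rw [Set.indicator_of_mem hx, Set.indicator_of_mem h2]
      exact hM t
    · rw [Set.indicator_of_notMem hx, norm_zero]
      exact Set.indicator_nonneg (fun _ _ => (norm_nonneg _).trans (hM 0)) _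

/-- The decomposition of the iterated integral of `φ K` into the integral outside a ball, the
integral of `(φ - φ(0)) K` over the ball, and a multiple of `φ(0)`. -/
theorem iterated_integral_eq (hK : IsCriticalKernel K) (hn : 0 < n) (φ : 𝓢(Space n r, ℂ))
    (hφ : Integrable fun y : Horiz n => ∫ t : Centre r, φ (y, t) * K (y, t)) {ε : ℝ} (hε : 0 < ε)
    (hε1 : ε ≤ 1) :
    Integrable (fun y => φ 0 * fibreIntegral K ε y) ∧
    ∫ y : Horiz n, ∫ t : Centre r, φ (y, t) * K (y, t) =
      (∫ x in (homBall n r ε)ᶜ, φ x * K x) + (∫ x in homBall n r ε, (φ x - φ 0) * K x) +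
        φ 0 * ballConstant K := by
  have : Nonempty (Fin (2 * n)) := ⟨⟨0, by omega⟩⟩
  obtain ⟨C₁, hC₁⟩ := exists_homNorm_mul_le φ
  obtain ⟨C₂, hC₂0, hC₂⟩ := exists_norm_sub_le φ
  have i1 : Integrable ((homBall n r ε)ᶜ.indicator fun x => φ x * K x) :=
    (hK.integrableOn_homBall_compl φ.continuous hC₁ hε).integrable_indicator
      (measurableSet_homBall ε).compl
  have i2 : Integrable ((homBall n r ε).indicator fun x => (φ x - φ 0) * K x) :=
    (hK.integrableOn_homBall hn (φ.continuous.sub continuous_const) hC₂0 hε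
      fun x hx => hC₂ x (hx.trans hε1)).integrable_indicator (measurableSet_homBall ε)
  have hy : ∀ᵐ y : Horiz n, y ≠ 0 := Measure.ae_ne volume 0
  have key : ∀ᵐ y : Horiz n, ∫ t : Centre r, φ (y, t) * K (y, t) =
      (∫ t : Centre r, (homBall n r ε)ᶜ.indicator (fun x => φ x * K x) (y, t)) +
      (∫ t : Centre r, (homBall n r ε).indicator (fun x => (φ x - φ 0) * K x) (y, t)) +
      φ 0 * fibreIntegral K ε y := by
    filter_upwards [hy, i1.prod_right_ae, i2.prod_right_ae] with y hy h1 h2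
    have h12 : Integrable fun t : Centre r =>
        (homBall n r ε)ᶜ.indicator (fun x => φ x * K x) (y, t) +
        (homBall n r ε).indicator (fun x => (φ x - φ 0) * K x) (y, t) := h1.add h2
    rw [fibreIntegral, ← integral_const_mul, ← integral_add h1 h2,
      ← integral_add h12 ((hK.integrable_fibre_homBall ε hy).const_mul _)]
    refine integral_congr_ae (.of_forall fun t => ?_)
    by_cases hx : ((y, t) : Space n r) ∈ homBall n r ε
    · have hx' : ((y, t) : Space n r) ∉ (homBall n r ε)ᶜ := fun h => h hx
      simp only [Set.indicator_of_mem hx, Set.indicator_of_notMem hx']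
      ring
    · have hx' : ((y, t) : Space n r) ∈ (homBall n r ε)ᶜ := hx
      simp only [Set.indicator_of_notMem hx, Set.indicator_of_mem hx']
      ring
  have j1 := i1.integral_prod_left
  have j2 := i2.integral_prod_left
  -- Integrability in y of the fibre integrals cannot be read off from K. It follows by subtraction,
  -- as the other three terms of the decomposition are integrable in y.
  have j3 : Integrable (fun y => φ 0 * fibreIntegral K ε y) := by
    refine ((hφ.sub j1).sub j2).congr ?_
    filter_upwards [key] with y hy
    simp only [Pi.sub_apply, hy]
    ring
  refine ⟨j3, ?_⟩
  have j12 : Integrable fun y : Horiz n =>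
      (∫ t : Centre r, (homBall n r ε)ᶜ.indicator (fun x => φ x * K x) (y, t)) +
      ∫ t : Centre r, (homBall n r ε).indicator (fun x => (φ x - φ 0) * K x) (y, t) := j1.add j2
  rw [integral_congr_ae key, integral_add j12 j3, integral_add j1 j2, integral_const_mul,
    hK.integral_fibreIntegral hε, ← integral_prod _ i1, ← integral_prod _ i2,
    ← Measure.volume_eq_prod, integral_indicator (measurableSet_homBall ε).compl,
    integral_indicator (measurableSet_homBall ε)]

/-- In `iterated_integral_eq` the left side and the multiple of φ(0) do not depend on ε, and the
integral of (φ - φ(0))K over the ball tends to 0. -/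
theorem tendsto_truncated (hK : IsCriticalKernel K) (hn : 0 < n) (φ : 𝓢(Space n r, ℂ))
    (hφ : Integrable fun y : Horiz n => ∫ t : Centre r, φ (y, t) * K (y, t)) :
    Tendsto (fun ε : ℝ => ∫ x in (homBall n r ε)ᶜ, φ x * K x) (𝓝[>] 0)
      (𝓝 ((∫ y : Horiz n, ∫ t : Centre r, φ (y, t) * K (y, t)) - φ 0 * ballConstant K)) := by
  obtain ⟨C₂, hC₂0, hC₂⟩ := exists_norm_sub_le φ
  have h := (tendsto_const_nhds (x := (∫ y : Horiz n, ∫ t : Centre r, φ (y, t) * K (y, t)) -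
    φ 0 * ballConstant K)).sub
    (hK.tendsto_integral_homBall hn (f := fun x => φ x - φ 0) hC₂0 hC₂)
  rw [sub_zero] at h
  refine h.congr' ?_
  filter_upwards [Ioc_mem_nhdsGT (zero_lt_one (α := ℝ))] with ε hε
  rw [(hK.iterated_integral_eq hn φ hφ hε.1 hε.2).2]
  ring

/-- The shell is the difference of two balls, and the iterated integrals of K over them have the
same value. Fubini applies because K is integrable on the shell. -/
theorem integral_shell_eq_zero (hK : IsCriticalKernel K) (hn : 0 < n)
    (hφ : ∀ φ : 𝓢(Space n r, ℂ), Integrable fun y : Horiz n => ∫ t : Centre r, φ (y, t) * K (y, t))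
    {a b : ℝ} (ha : 0 < a) (hab : a ≤ b) (hb : b ≤ 1) : ∫ x in shell n r a b, K x = 0 := by
  have : Nonempty (Fin (2 * n)) := ⟨⟨0, by omega⟩⟩
  -- A test function with φ(0) = 1 turns the integrability of φ(0) times the fibre integral into
  -- that of the fibre integral itself.
  obtain ⟨φ, hφ0⟩ : ∃ φ : 𝓢(Space n r, ℂ), φ 0 = 1 := by
    let f : ContDiffBump (0 : Space n r) := ⟨1, 2, one_pos, one_lt_two⟩
    have hf : HasCompactSupport fun x => (f x : ℂ) :=
      f.hasCompactSupport.comp_left (g := fun z : ℝ => (z : ℂ)) Complex.ofReal_zero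
    have hf2 : ContDiff ℝ (⊤ : ℕ∞) fun x => (f x : ℂ) := Complex.ofRealCLM.contDiff.comp f.contDiff
    refine ⟨hf.toSchwartzMap hf2, ?_⟩
    have : f 0 = 1 := f.one_of_mem_closedBall (by simp [f])
    simp [this]
  have hint : ∀ ε : ℝ, 0 < ε → ε ≤ 1 → Integrable (fibreIntegral K ε) := by
    intro ε hε hε1
    have := (hK.iterated_integral_eq hn φ (hφ φ) hε hε1).1
    simpa [hφ0] using this
  have i1 : Integrable ((shell n r a b).indicator K) :=
    (hK.integrableOn_shell ha).integrable_indicator (measurableSet_shell a b)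
  rw [← integral_indicator (measurableSet_shell a b), Measure.volume_eq_prod, integral_prod _ i1]
  have hy : ∀ᵐ y : Horiz n, y ≠ 0 := Measure.ae_ne volume 0
  have key : ∀ᵐ y : Horiz n, ∫ t : Centre r, (shell n r a b).indicator K (y, t) =
      fibreIntegral K b y - fibreIntegral K a y := by
    filter_upwards [hy] with y hy
    rw [fibreIntegral, fibreIntegral, ← integral_sub (hK.integrable_fibre_homBall b hy)
      (hK.integrable_fibre_homBall a hy)]
    refine integral_congr_ae (.of_forall fun t => ?_)
    simp only [Set.indicator, shell, homBall, Set.mem_preimage, Set.mem_Ioc, Set.mem_ofPred_eq]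
    by_cases h1 : homNorm ((y, t) : Space n r) ≤ a
    · simp [h1, not_lt.2 h1, h1.trans hab]
    · by_cases h2 : homNorm ((y, t) : Space n r) ≤ b <;> simp [h1, h2, not_le.1 h1]
  rw [integral_congr_ae key, integral_sub (hint b (ha.trans_le hab) hb) (hint a ha (hab.trans hb)),
    hK.integral_fibreIntegral ha, hK.integral_fibreIntegral (ha.trans_le hab), sub_self]

end IsCriticalKernel

end

end StepTwo

/-! ### From vanishing shell integrals to mean value zero on the sphere -/

namespace StepTwo

noncomputable section

variable {n r : ℕ} {K : Space n r → ℂ}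

theorem integral_pow_indicator {d : ℕ} {N : ℝ} (hN0 : 0 ≤ N) (hN1 : N ≤ 1) :
    ∫ s in Set.Ioc (0 : ℝ) 1, (Set.Iio N).indicator (fun s => ((d : ℝ) + 1) * s ^ d) s =
      N ^ (d + 1) := by
  rw [setIntegral_indicator measurableSet_Iio]
  have h : Set.Ioc (0 : ℝ) 1 ∩ Set.Iio N = Set.Ioo 0 N := by
    ext s
    simp only [Set.mem_inter_iff, Set.mem_Ioc, Set.mem_Iio, Set.mem_Ioo]
    exact ⟨fun h => ⟨h.1.1, h.2⟩, fun h => ⟨⟨h.1, h.2.le.trans hN1⟩, h.2⟩⟩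
  rw [h, ← integral_Ioc_eq_integral_Ioo, ← intervalIntegral.integral_of_le hN0,
    intervalIntegral.integral_const_mul, integral_pow]
  field_simp
  simp

theorem integrableOn_pow_indicator {d : ℕ} (N : ℝ) :
    IntegrableOn (fun s : ℝ => (Set.Iio N).indicator (fun s => ((d : ℝ) + 1) * s ^ d) s)
      (Set.Ioc (0 : ℝ) 1) := by
  refine IntegrableOn.indicator ?_ measurableSet_Iio
  exact (Continuous.integrableOn_Icc (by fun_prop)).mono_set Set.Ioc_subset_Icc_self

namespace IsCriticalKernel

theorem norm_ofReal_homNorm_pow_le {d : ℕ} (x : Space n r) (hx : homNorm x ≤ 1) :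
    ‖((homNorm x ^ (d + 1) : ℝ) : ℂ)‖ ≤ 1 * homNorm x := by
  have h0 := homNorm_nonneg x
  rw [Complex.norm_real, Real.norm_of_nonneg (by positivity), one_mul]
  exact pow_le_of_le_one h0 hx (by omega)

theorem integrableOn_homNorm_pow_mul (hK : IsCriticalKernel K) (hn : 0 < n) (d : ℕ) :
    IntegrableOn (fun x => ((homNorm x ^ (d + 1) : ℝ) : ℂ) * K x) (homBall n r 1) :=
  hK.integrableOn_homBall hn (Complex.continuous_ofReal.comp (continuous_homNorm.pow _))
    zero_le_one one_pos norm_ofReal_homNorm_pow_le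

/-- A radial weight integrates to zero against a kernel whose shell integrals vanish. -/
theorem integral_homNorm_pow_mul_eq_zero (hK : IsCriticalKernel K) (hn : 0 < n)
    (h0 : ∀ a : ℝ, 0 < a → a ≤ 1 → ∫ x in shell n r a 1, K x = 0) (d : ℕ) :
    ∫ x in homBall n r 1, ((homNorm x ^ (d + 1) : ℝ) : ℂ) * K x = 0 := by
  -- Layer cake: for |x| ≤ 1, |x|^{d+1} is the integral of (d+1)s^d over 0 < s < |x|. After
  -- interchanging the integrals, the inner one is (d+1)s^d times the integral of K over the shell s
  -- < |x| ≤ 1, which vanishes.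
  set g : ℝ → ℝ → ℝ := fun N s => (Set.Iio N).indicator (fun s => ((d : ℝ) + 1) * s ^ d) s with hg
  have hgm : Measurable fun p : ℝ × ℝ => g p.1 p.2 := by
    have : (fun p : ℝ × ℝ => g p.1 p.2) =
        {p : ℝ × ℝ | p.2 < p.1}.indicator (fun p => ((d : ℝ) + 1) * p.2 ^ d) := by
      funext p
      by_cases h : p.2 < p.1 <;> simp [hg, h, Set.indicator]
    rw [this]
    exact Measurable.indicator (by fun_prop) (measurableSet_lt measurable_snd measurable_fst)
  have hg0 : ∀ N s, s ∈ Set.Ioc (0 : ℝ) 1 → 0 ≤ g N s := fun N s hs =>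
    Set.indicator_apply_nonneg fun _ => by have := hs.1.le; positivity
  set H : Space n r → ℝ → ℂ := fun x s => (g (homNorm x) s : ℂ) * K x with hH
  have hHm : AEStronglyMeasurable (Function.uncurry H)
      ((volume.restrict (homBall n r 1)).prod (volume.restrict (Set.Ioc (0 : ℝ) 1))) := by
    refine Measurable.aestronglyMeasurable ?_
    refine Measurable.mul (Complex.measurable_ofReal.comp ?_)
      (hK.stronglyMeasurable.measurable.comp measurable_fst)
    exact hgm.comp ((continuous_homNorm.measurable.comp measurable_fst).prodMk measurable_snd)
  have hHi : Integrable (Function.uncurry H)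
      ((volume.restrict (homBall n r 1)).prod (volume.restrict (Set.Ioc (0 : ℝ) 1))) := by
    rw [integrable_prod_iff hHm]
    constructor
    · refine .of_forall fun x => ?_
      exact ((integrableOn_pow_indicator (homNorm x)).ofReal (𝕜 := ℂ)).mul_const (K x)
    · refine (hK.integrableOn_homNorm_pow_mul hn d).norm.congr ?_
      filter_upwards [ae_restrict_mem (measurableSet_homBall 1)] with x hx
      have h1 : ∀ s ∈ Set.Ioc (0 : ℝ) 1, ‖Function.uncurry H (x, s)‖ = g (homNorm x) s * ‖K x‖ := by
        intro s hs
        simp only [Function.uncurry, hH, norm_mul, Complex.norm_real]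
        rw [Real.norm_of_nonneg (hg0 _ s hs)]
      rw [setIntegral_congr_fun measurableSet_Ioc h1, integral_mul_const,
        integral_pow_indicator (homNorm_nonneg x) hx, norm_mul, Complex.norm_real,
        Real.norm_of_nonneg (pow_nonneg (homNorm_nonneg x) _)]
  have hswap := integral_integral_swap hHi
  have hl : ∀ x ∈ homBall n r 1, ((homNorm x ^ (d + 1) : ℝ) : ℂ) * K x =
      ∫ s in Set.Ioc (0 : ℝ) 1, H x s := by
    intro x hx
    simp only [hH]
    rw [integral_mul_const, integral_complex_ofReal,
      integral_pow_indicator (homNorm_nonneg x) hx]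
  rw [setIntegral_congr_fun (measurableSet_homBall 1) hl, hswap]
  refine setIntegral_eq_zero_of_forall_eq_zero fun s hs => ?_
  have h3 : ∀ x ∈ homBall n r 1, H x s = (shell n r s 1).indicator
      (fun x => (((d : ℝ) + 1) * s ^ d : ℝ) * K x) x := by
    intro x hx
    have hx' : homNorm x ≤ 1 := hx
    by_cases hs' : s < homNorm x <;> simp [hH, hg, shell, Set.indicator, hx', hs']
  rw [setIntegral_congr_fun (measurableSet_homBall 1) h3,
    setIntegral_indicator (measurableSet_shell s 1)]
  have h4 : homBall n r 1 ∩ shell n r s 1 = shell n r s 1 :=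
    Set.inter_eq_right.2 fun x hx => hx.2
  rw [h4, integral_const_mul, h0 s hs.1 hs.2, mul_zero]

end IsCriticalKernel

/-- The projection of the space to the homogeneous unit sphere along the dilations. -/
def sphereProj (x : Space n r) : Space n r := dil (homNorm x)⁻¹ x

theorem measurable_sphereProj : Measurable (sphereProj : Space n r → Space n r) := by
  have h : Measurable fun x : Space n r => (homNorm x)⁻¹ := continuous_homNorm.measurable.inv
  exact (h.smul measurable_fst).prodMk ((h.pow_const 2).smul measurable_snd)

theorem sphereMeasure_eq : sphereMeasure n r = ((2 * n + 2 * r : ℕ) : ℝ≥0∞) •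
    ((volume.restrict (homBall n r 1)).map sphereProj) := rfl

theorem homNorm_sphereProj {x : Space n r} (hx : x ≠ 0) : homNorm (sphereProj x) = 1 := by
  rw [sphereProj, homNorm_dil (inv_nonneg.2 (homNorm_nonneg x)),
    inv_mul_cancel₀ (homNorm_pos hx).ne']

theorem sphereMeasure_ae {p : Space n r → Prop} (hpm : MeasurableSet {x | p x})
    (hp : ∀ᵐ x : Space n r, p (sphereProj x)) : ∀ᵐ x ∂sphereMeasure n r, p x := by
  rw [sphereMeasure_eq]
  refine Measure.ae_smul_measure ?_ _
  rw [ae_map_iff measurable_sphereProj.aemeasurable hpm]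
  exact ae_restrict_of_ae hp

namespace IsCriticalKernel

theorem comp_sphereProj (hK : IsCriticalKernel K) {x : Space n r} (hx : x ≠ 0) :
    K (sphereProj x) = ((homNorm x ^ (2 * n + 2 * r) : ℝ) : ℂ) * K x := by
  rw [sphereProj, hK.dil _ (inv_pos.2 (homNorm_pos hx)), inv_pow, inv_inv]

/-- The surface measure is a multiple of the image of the volume of the unit ball under the
projection. Away from the origin, K at the projected point is |x|^{2n+2r} K(x), so the sphere
integral is the integral of K against a radial weight. -/
theorem sphere (hK : IsCriticalKernel K) (hn : 0 < n)
    (h0 : ∀ a : ℝ, 0 < a → a ≤ 1 → ∫ x in shell n r a 1, K x = 0) :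
    Integrable K (sphereMeasure n r) ∧ ∫ x, K x ∂sphereMeasure n r = 0 := by
  obtain ⟨d, hd⟩ : ∃ d, 2 * n + 2 * r = d + 1 := ⟨2 * n + 2 * r - 1, by omega⟩
  have hx0 : ∀ᵐ x : Space n r, x ≠ 0 := by
    filter_upwards [ae_fst_ne_zero (r := r) hn] with x hx h
    exact hx (by rw [h]; rfl)
  have hae : (fun x => ((homNorm x ^ (d + 1) : ℝ) : ℂ) * K x) =ᵐ[volume.restrict (homBall n r 1)]
      K ∘ sphereProj := by
    refine ae_restrict_of_ae ?_
    filter_upwards [hx0] with x hx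
    rw [Function.comp_apply, hK.comp_sphereProj hx, hd]
  have hKm : AEStronglyMeasurable K ((volume.restrict (homBall n r 1)).map sphereProj) :=
    hK.stronglyMeasurable.aestronglyMeasurable
  rw [sphereMeasure_eq]
  constructor
  · refine Integrable.smul_measure ?_ (ENNReal.natCast_ne_top _)
    rw [integrable_map_measure hKm measurable_sphereProj.aemeasurable]
    exact (hK.integrableOn_homNorm_pow_mul hn d).congr hae
  · rw [integral_smul_measure, integral_map measurable_sphereProj.aemeasurable hKm]
    have : ∫ x in homBall n r 1, K (sphereProj x) = 0 := by
      rw [← hK.integral_homNorm_pow_mul_eq_zero hn h0 d]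
      exact (integral_congr_ae hae).symm
    rw [this, smul_zero]

end IsCriticalKernel

end

end StepTwo

/-! ### The pairing 𝒫_m: convergence, continuity and its form as an iterated integral -/

namespace StepTwo

noncomputable section

variable {n r : ℕ} {B : Fin r → Matrix (Fin (2 * n)) (Fin (2 * n)) ℝ}

theorem IsNondegenerate.isCriticalKernel_PmAux (hB : IsNondegenerate B)
    (F : ∀ ω : Centre r, NormalFrame (BTau B ω)) (m : ℕ) : IsCriticalKernel (PmAux F m) where
  stronglyMeasurable := hB.stronglyMeasurable_PmAux F m
  dil _ hc x := PmAux_dil F m hc x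
  shell_lt_top := hB.lintegral_shell_PmAux_lt_top F m
  bounded_fibre y _ := by
    refine ⟨‖1 / (2 * Real.pi : ℂ) ^ r‖ * ∫ τ, ‖Qm F m y τ‖, fun t => ?_⟩
    rw [PmAux, norm_mul]
    gcongr
    refine (norm_integral_le_integral_norm _).trans (le_of_eq ?_)
    simp only [norm_mul, norm_exp_I_mul, one_mul, Complex.norm_real]

theorem norm_iteratedFDeriv_fibre_le (φ : 𝓢(Space n r, ℂ)) (p : ℕ) (y : Horiz n) (t : Centre r) :
    ‖iteratedFDeriv ℝ p (fun t => φ (y, t)) t‖ ≤ ‖iteratedFDeriv ℝ p φ (y, t)‖ := by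
  have hg : ContDiff ℝ p fun x : Space n r => φ ((y, 0) + x) :=
    (φ.smooth p).comp (contDiff_const.add contDiff_id)
  have h1 : (fun t : Centre r => φ (y, t)) =
      (fun x : Space n r => φ ((y, 0) + x)) ∘ ContinuousLinearMap.inr ℝ (Horiz n) (Centre r) := by
    funext t
    simp
  rw [h1, ContinuousLinearMap.iteratedFDeriv_comp_right _ hg _ le_rfl,
    iteratedFDeriv_comp_add_left]
  refine (ContinuousMultilinearMap.norm_compContinuousLinearMap_le _ _).trans ?_
  have h2 : ∏ _i : Fin p, ‖ContinuousLinearMap.inr ℝ (Horiz n) (Centre r)‖ ≤ 1 :=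
    Finset.prod_le_one (fun _ _ => norm_nonneg _)
      fun _ _ => ContinuousLinearMap.norm_inr_le_one ℝ _ _
  refine (mul_le_of_le_one_right (norm_nonneg _) h2).trans (le_of_eq ?_)
  simp

theorem partialFourier_eq_osc (φ : 𝓢(Space n r, ℂ)) (y : Horiz n) (τ : Centre r) :
    partialFourier φ y τ = osc (fun t => φ (y, t)) (-τ) := by
  simp [partialFourier, osc]

/-- The Schwartz seminorm that controls `N` derivatives with `k` powers of decay. -/
abbrev schwartzBound (k N : ℕ) (φ : 𝓢(Space n r, ℂ)) : ℝ :=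
  (Finset.Iic (k, N)).sup (schwartzSeminormFamily ℂ (Space n r) ℂ) φ

/-- N derivatives in t give N powers of decay in τ. The weight 2n + 1 + (r + 1) is split into the
decay kept in y and the decay spent on integrating in t. -/
theorem exists_partialFourier_le (n r N : ℕ) : ∃ C : ℝ, 0 ≤ C ∧
    ∀ (φ : 𝓢(Space n r, ℂ)) (y : Horiz n) (τ : Centre r),
      (1 + ‖τ‖) ^ N * ‖partialFourier φ y τ‖ ≤
        C * schwartzBound (2 * n + 1 + (r + 1)) N φ * ((1 + ‖y‖) ^ (2 * n + 1))⁻¹ := by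
  obtain ⟨C, hC, h⟩ := pow_mul_norm_osc_le (r := r) N
  set k := 2 * n + 1 + (r + 1) with hk
  set J := ∫ t : Centre r, ((1 + ‖t‖) ^ (r + 1))⁻¹ with hJ
  have hJ0 : 0 ≤ J := integral_nonneg fun t => by positivity
  have hint : Integrable fun t : Centre r => ((1 + ‖t‖) ^ (r + 1))⁻¹ :=
    integrable_inv_one_add_norm_pow volume (by simp)
  refine ⟨C * ((N + 1) * (2 ^ k * J)), by positivity, fun φ y τ => ?_⟩
  set S := schwartzBound k N φ with hS
  have hb : ∀ p ≤ N, ∀ t, ‖iteratedFDeriv ℝ p (fun t => φ (y, t)) t‖ ≤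
      2 ^ k * S * ((1 + ‖y‖) ^ (2 * n + 1))⁻¹ * ((1 + ‖t‖) ^ (r + 1))⁻¹ := by
    intro p hp t
    refine (norm_iteratedFDeriv_fibre_le φ p y t).trans ?_
    have h1 := φ.one_add_le_sup_seminorm_apply (𝕜 := ℂ) (m := (k, N)) (k := k) (n := p)
      le_rfl hp (y, t)
    change _ ≤ 2 ^ k * S at h1
    have h2 : (1 + ‖y‖) ^ (2 * n + 1) * (1 + ‖t‖) ^ (r + 1) ≤ (1 + ‖((y, t) : Space n r)‖) ^ k := by
      rw [hk, pow_add _ (2 * n + 1)]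
      gcongr
      · exact norm_fst_le ((y, t) : Space n r)
      · exact norm_snd_le ((y, t) : Space n r)
    rw [mul_assoc, ← mul_inv, ← div_eq_mul_inv, le_div_iff₀ (by positivity), mul_comm]
    exact (mul_le_mul_of_nonneg_right h2 (norm_nonneg _)).trans h1
  have hsm : ContDiff ℝ N fun t : Centre r => φ (y, t) :=
    (φ.smooth N).comp (contDiff_const.prodMk contDiff_id)
  have hi : ∀ p ≤ N, Integrable fun t => ‖iteratedFDeriv ℝ p (fun t : Centre r => φ (y, t)) t‖ := by
    intro p hp
    refine (hint.const_mul (2 ^ k * S * ((1 + ‖y‖) ^ (2 * n + 1))⁻¹)).mono' ?_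
      (.of_forall fun t => by simpa using hb p hp t)
    exact (hsm.continuous_iteratedFDeriv (by exact_mod_cast hp)).norm.aestronglyMeasurable
  have h3 := h _ hsm hi (-τ)
  rw [norm_neg, ← partialFourier_eq_osc] at h3
  have h4 : ∑ p ∈ Finset.range (N + 1),
      ∫ t, ‖iteratedFDeriv ℝ p (fun t : Centre r => φ (y, t)) t‖ ≤
      ∑ _p ∈ Finset.range (N + 1), 2 ^ k * S * ((1 + ‖y‖) ^ (2 * n + 1))⁻¹ * J := by
    refine Finset.sum_le_sum fun p hp => ?_
    have hp' : p ≤ N := by simp at hp; omega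
    rw [hJ, ← integral_const_mul]
    exact integral_mono (hi p hp') (hint.const_mul _) (hb p hp')
  rw [Finset.sum_const, Finset.card_range, nsmul_eq_mul] at h4
  calc _ ≤ _ := h3
    _ ≤ C * _ := mul_le_mul_of_nonneg_left h4 hC
    _ = _ := by push_cast; ring

theorem stronglyMeasurable_partialFourier (φ : 𝓢(Space n r, ℂ)) :
    StronglyMeasurable fun p : Space n r => partialFourier φ p.1 (-p.2) := by
  unfold partialFourier
  refine StronglyMeasurable.integral_prod_right'
    (f := fun q : Space n r × Centre r => Complex.exp (-Complex.I * (inner ℝ (-q.1.2) q.2 : ℝ)) *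
      φ (q.1.1, q.2)) ?_
  have := φ.continuous
  exact Continuous.stronglyMeasurable (by fun_prop)

theorem partialFourier_add (φ ψ : 𝓢(Space n r, ℂ)) (y : Horiz n) (τ : Centre r) :
    partialFourier (φ + ψ) y τ = partialFourier φ y τ + partialFourier ψ y τ := by
  have h : ∀ χ : 𝓢(Space n r, ℂ), Integrable fun t : Centre r =>
      Complex.exp (-Complex.I * (inner ℝ τ t : ℝ)) * χ (y, t) := by
    intro χ
    refine (integrable_fibre χ y).bdd_mul (c := 1)
      (Continuous.aestronglyMeasurable (by fun_prop)) (.of_forall fun t => ?_)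
    rw [neg_mul, ← mul_neg, ← Complex.ofReal_neg, norm_exp_I_mul]
  simp only [partialFourier, add_apply, mul_add]
  exact integral_add (h φ) (h ψ)

theorem partialFourier_smul (a : ℂ) (φ : 𝓢(Space n r, ℂ)) (y : Horiz n) (τ : Centre r) :
    partialFourier (a • φ) y τ = a * partialFourier φ y τ := by
  simp only [partialFourier, smul_apply, smul_eq_mul, ← integral_const_mul]
  exact integral_congr_ae (.of_forall fun t => by simp only; ring)

variable (F : ∀ ω : Centre r, NormalFrame (BTau B ω)) (m : ℕ)

/-- Q_m grows at most like |τ|^n uniformly in y, so n + (r + 1) powers of decay of the partial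
Fourier transform leave an integrable majorant. -/
theorem IsNondegenerate.exists_pairingIntegrand_le (hB : IsNondegenerate B) :
    ∃ C : ℝ, 0 ≤ C ∧ ∀ (φ : 𝓢(Space n r, ℂ)) (p : Space n r), ‖pairingIntegrand F m φ p‖ ≤
      C * schwartzBound (2 * n + 1 + (r + 1)) (n + (r + 1)) φ *
        (((1 + ‖p.1‖) ^ (2 * n + 1))⁻¹ * ((1 + ‖p.2‖) ^ (r + 1))⁻¹) := by
  obtain ⟨C, c, hC, hc, h⟩ := hB.exists_abs_Qm_le F m
  obtain ⟨D, hD, h'⟩ := exists_partialFourier_le n r (n + (r + 1))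
  refine ⟨C * D, by positivity, fun φ ⟨y, τ⟩ => ?_⟩
  have h1 : |Qm F m y τ| ≤ C * (1 + ‖τ‖) ^ n := by
    refine (h y τ).trans ?_
    have h2 : Real.exp (-(c * ‖τ‖ * ‖y‖ ^ 2)) ≤ 1 := by
      rw [Real.exp_le_one_iff, neg_nonpos]; positivity
    have h3 : ‖τ‖ ^ n ≤ (1 + ‖τ‖) ^ n := by gcongr; linarith
    calc _ ≤ C * ‖τ‖ ^ n * 1 := by gcongr
      _ ≤ _ := by rw [mul_one]; gcongr
  have h4 := h' φ y (-τ)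
  rw [norm_neg, pow_add, mul_assoc] at h4
  rw [pairingIntegrand, norm_mul, Complex.norm_real, Real.norm_eq_abs, ← mul_assoc,
    ← div_eq_mul_inv _ ((1 + ‖τ‖) ^ (r + 1)), le_div_iff₀ (by positivity)]
  calc _ ≤ C * (1 + ‖τ‖) ^ n * ‖partialFourier φ y (-τ)‖ * (1 + ‖τ‖) ^ (r + 1) := by gcongr
    _ = C * ((1 + ‖τ‖) ^ n * ((1 + ‖τ‖) ^ (r + 1) * ‖partialFourier φ y (-τ)‖)) := by ring
    _ ≤ C * _ := mul_le_mul_of_nonneg_left h4 hC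
    _ = _ := by ring

theorem integrable_inv_mul_inv (n r : ℕ) : Integrable fun p : Space n r =>
    ((1 + ‖p.1‖) ^ (2 * n + 1))⁻¹ * ((1 + ‖p.2‖) ^ (r + 1))⁻¹ :=
  Integrable.mul_prod (f := fun y : Horiz n => ((1 + ‖y‖) ^ (2 * n + 1))⁻¹)
    (g := fun t : Centre r => ((1 + ‖t‖) ^ (r + 1))⁻¹)
    (integrable_inv_one_add_norm_pow volume (by simp))
    (integrable_inv_one_add_norm_pow volume (by simp))

theorem IsNondegenerate.integrable_pairingIntegrand (hB : IsNondegenerate B)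
    (φ : 𝓢(Space n r, ℂ)) : Integrable (pairingIntegrand F m φ) := by
  obtain ⟨C, -, h⟩ := hB.exists_pairingIntegrand_le F m
  refine ((integrable_inv_mul_inv n r).const_mul _).mono' ?_ (.of_forall (h φ))
  exact ((Complex.measurable_ofReal.comp (hB.measurable_Qm F m)).stronglyMeasurable.mul
    (stronglyMeasurable_partialFourier φ)).aestronglyMeasurable

theorem IsNondegenerate.exists_pairing_le (hB : IsNondegenerate B) :
    ∃ (s : Finset (ℕ × ℕ)) (C : ℝ), 0 ≤ C ∧ ∀ φ : 𝓢(Space n r, ℂ),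
      ‖pairing F m φ‖ ≤ C * s.sup (schwartzSeminormFamily ℂ (Space n r) ℂ) φ := by
  obtain ⟨C, hC, h⟩ := hB.exists_pairingIntegrand_le F m
  refine ⟨Finset.Iic (2 * n + 1 + (r + 1), n + (r + 1)), ‖1 / (2 * Real.pi : ℂ) ^ r‖ * (C *
    ∫ p : Space n r, ((1 + ‖p.1‖) ^ (2 * n + 1))⁻¹ * ((1 + ‖p.2‖) ^ (r + 1))⁻¹),
    mul_nonneg (norm_nonneg _) (mul_nonneg hC (integral_nonneg fun p => by positivity)),
    fun φ => ?_⟩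
  rw [pairing, norm_mul, mul_assoc]
  refine mul_le_mul_of_nonneg_left ?_ (norm_nonneg _)
  refine (norm_integral_le_of_norm_le ((integrable_inv_mul_inv n r).const_mul _)
    (.of_forall (h φ))).trans (le_of_eq ?_)
  rw [integral_const_mul, schwartzBound]
  ring

/-- The tempered distribution `𝒫_m`. -/
def IsNondegenerate.pairingDistribution (hB : IsNondegenerate B) : 𝓢'(Space n r, ℂ) :=
  ContinuousLinearMap.toPointwiseConvergenceCLM _ _ _ _ <|
    SchwartzMap.mkCLMtoNormedSpace (𝕜 := ℂ) (σ := RingHom.id ℂ) (pairing F m)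
      (fun φ ψ => by
        rw [pairing, pairing, pairing, ← mul_add, ← integral_add
          (hB.integrable_pairingIntegrand F m φ) (hB.integrable_pairingIntegrand F m ψ)]
        simp only [pairingIntegrand, partialFourier_add, mul_add])
      (fun a φ => by
        simp only [pairing, pairingIntegrand, partialFourier_smul, RingHom.id_apply, smul_eq_mul,
          mul_left_comm _ a, integral_const_mul])
      (hB.exists_pairing_le F m)

/-- Fubini in (τ, t) at fixed y ≠ 0, where Q_m(y, ·) is integrable. The integration in y stays
outside, which is why the pairing becomes an iterated rather than an absolutely convergent integral
of φ P_m. -/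
theorem IsNondegenerate.integral_pairingIntegrand_right (hB : IsNondegenerate B)
    (φ : 𝓢(Space n r, ℂ)) {y : Horiz n} (hy : y ≠ 0) :
    1 / (2 * Real.pi : ℂ) ^ r * ∫ τ : Centre r, pairingIntegrand F m φ (y, τ) =
      ∫ t : Centre r, φ (y, t) * PmAux F m (y, t) := by
  have h1 : Integrable fun q : Centre r × Centre r => Complex.exp (Complex.I *
      (inner ℝ q.1 q.2 : ℝ)) * ((Qm F m y q.1 : ℂ) * φ (y, q.2)) := by
    refine (Integrable.mul_prod (hB.integrable_Qm F m hy).ofReal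
      (integrable_fibre φ y)).bdd_mul (c := 1) (Continuous.aestronglyMeasurable (by fun_prop))
      (.of_forall fun t => (norm_exp_I_mul _).le)
  have h2 := integral_integral_swap (f := fun τ t : Centre r => Complex.exp (Complex.I *
      (inner ℝ τ t : ℝ)) * ((Qm F m y τ : ℂ) * φ (y, t))) h1
  simp only [pairingIntegrand, partialFourier_eq_osc, osc, neg_neg, PmAux]
  have h3 : ∀ τ : Centre r, (Qm F m y τ : ℂ) * ∫ t : Centre r,
      Complex.exp (Complex.I * (inner ℝ τ t : ℝ)) * φ (y, t) = ∫ t : Centre r,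
      Complex.exp (Complex.I * (inner ℝ τ t : ℝ)) * ((Qm F m y τ : ℂ) * φ (y, t)) := by
    intro τ
    rw [← integral_const_mul]
    exact integral_congr_ae (.of_forall fun t => by simp only; ring)
  simp only [h3]
  rw [h2, ← integral_const_mul]
  refine integral_congr_ae (.of_forall fun t => ?_)
  simp only
  rw [mul_left_comm, ← integral_const_mul (φ (y, t))]
  congr 1
  refine integral_congr_ae (.of_forall fun τ => ?_)
  simp only [real_inner_comm t τ]
  ring

theorem IsNondegenerate.ae_integral_pairingIntegrand_right (hB : IsNondegenerate B)
    (φ : 𝓢(Space n r, ℂ)) : ∀ᵐ y : Horiz n,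
    1 / (2 * Real.pi : ℂ) ^ r * ∫ τ : Centre r, pairingIntegrand F m φ (y, τ) =
      ∫ t : Centre r, φ (y, t) * PmAux F m (y, t) := by
  have : Nonempty (Fin (2 * n)) := ⟨⟨0, by have := hB.horiz_pos; omega⟩⟩
  filter_upwards [Measure.ae_ne volume (0 : Horiz n)] with y hy
  exact hB.integral_pairingIntegrand_right F m φ hy

theorem IsNondegenerate.integrable_integral_mul_PmAux (hB : IsNondegenerate B)
    (φ : 𝓢(Space n r, ℂ)) :
    Integrable fun y : Horiz n => ∫ t : Centre r, φ (y, t) * PmAux F m (y, t) :=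
  ((hB.integrable_pairingIntegrand F m φ).integral_prod_left.const_mul _).congr
    (hB.ae_integral_pairingIntegrand_right F m φ)

theorem IsNondegenerate.pairing_eq (hB : IsNondegenerate B) (φ : 𝓢(Space n r, ℂ)) :
    pairing F m φ = ∫ y : Horiz n, ∫ t : Centre r, φ (y, t) * PmAux F m (y, t) := by
  rw [pairing, Measure.volume_eq_prod, integral_prod _ (hB.integrable_pairingIntegrand F m φ),
    ← integral_const_mul]
  exact integral_congr_ae (hB.ae_integral_pairingIntegrand_right F m φ)

end

end StepTwo



/-! ### Assembly of the theorem -/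

theorem theorem1p1 {n r : ℕ} (B : Fin r → Matrix (Fin (2 * n)) (Fin (2 * n)) ℝ)
    (hB : IsNondegenerate B) (F : ∀ ω : Centre r, NormalFrame (BTau B ω)) (m : ℕ) :
    -- the integral defining `P_m` converges
    (∀ y : Horiz n, y ≠ 0 → Integrable (fun τ : Centre r => Qm F m y τ)) ∧
    -- `𝒫_m` and `p.v. P_m` are well-defined tempered distributions and `𝒫_m = p.v. P_m + C δ_0`
    (∃ Pdist pvP : 𝓢'(Space n r, ℂ),
      (∀ φ : 𝓢(Space n r, ℂ), Integrable (pairingIntegrand F m φ) ∧ Pdist φ = pairing F m φ) ∧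
      (∀ φ : 𝓢(Space n r, ℂ),
        (∀ ε : ℝ, 0 < ε → IntegrableOn (fun x => φ x * Pm F m x) (homBall n r ε)ᶜ) ∧
        Tendsto (fun ε : ℝ => ∫ x in (homBall n r ε)ᶜ, φ x * Pm F m x) (𝓝[>] 0)
          (𝓝 (pvP φ))) ∧
      ∃ C : ℂ, Pdist = pvP + C • TemperedDistribution.delta 0) ∧
    -- `P_m` has mean value zero over the homogeneous unit sphere
    IntegrableOn (Pm F m) (homSphere n r) (sphereMeasure n r) ∧
    ∫ x in homSphere n r, Pm F m x ∂sphereMeasure n r = 0 := by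
  have hK := hB.isCriticalKernel_PmAux F m
  have hn := hB.horiz_pos
  have hφ := hB.integrable_integral_mul_PmAux F m
  have hP : ∀ (φ : 𝓢(Space n r, ℂ)), (fun x => φ x * PmAux F m x) =ᵐ[volume]
      fun x => φ x * Pm F m x := fun φ => by
    filter_upwards [ae_fst_ne_zero (r := r) hn] with x hx
    rw [Pm_eq_PmAux F m hx]
  -- The principal value is defined as 𝒫_m - Cδ₀ with C the iterated integral of P_m over the unit
  -- ball. It is then tempered for free, and only the limit of the truncated integrals remains to be
  -- identified.
  refine ⟨fun y hy => hB.integrable_Qm F m hy, ⟨hB.pairingDistribution F m,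
    hB.pairingDistribution F m - ballConstant (PmAux F m) • TemperedDistribution.delta 0,
    fun φ => ⟨hB.integrable_pairingIntegrand F m φ, rfl⟩, fun φ => ⟨fun ε hε => ?_, ?_⟩,
    ballConstant (PmAux F m), by simp⟩, ?_⟩
  · obtain ⟨C, hC⟩ := exists_homNorm_mul_le φ
    exact (hK.integrableOn_homBall_compl φ.continuous hC hε).congr (ae_restrict_of_ae (hP φ))
  · have h := hK.tendsto_truncated hn φ (hφ φ)
    rw [← hB.pairing_eq, mul_comm (φ 0)] at h
    refine h.congr fun ε => integral_congr_ae (ae_restrict_of_ae (hP φ))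
  · have hs : (sphereMeasure n r).restrict (homSphere n r) = sphereMeasure n r := by
      refine Measure.restrict_eq_self_of_ae_mem (sphereMeasure_ae
        (continuous_homNorm.measurable (measurableSet_singleton (1 : ℝ))) ?_)
      filter_upwards [ae_fst_ne_zero (r := r) hn] with x hx
      exact homNorm_sphereProj fun h => hx (by rw [h]; rfl)
    -- The projection preserves y ≠ 0, and the plane y = 0 is null for the volume, so its trace on
    -- the sphere is null as well.
    have hPs : PmAux F m =ᵐ[sphereMeasure n r] Pm F m := by
      have h : ∀ᵐ x ∂sphereMeasure n r, x.1 ≠ 0 := by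
        refine sphereMeasure_ae (isOpen_ne_fun continuous_fst continuous_const).measurableSet ?_
        filter_upwards [ae_fst_ne_zero (r := r) hn] with x hx
        exact smul_ne_zero (inv_ne_zero (homNorm_pos fun h => hx (by rw [h]; rfl)).ne') hx
      filter_upwards [h] with x hx
      rw [Pm_eq_PmAux F m hx]
    obtain ⟨h1, h2⟩ := hK.sphere hn fun a ha ha1 =>
      hK.integral_shell_eq_zero hn hφ ha ha1 le_rfl
    rw [IntegrableOn, hs]
    exact ⟨h1.congr hPs, by rw [← integral_congr_ae hPs, h2]⟩
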